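/- Let $G$ be a compact Lie group whose Lie algebra $\mathfrak g$ is simple, let $g_0$ be the negative of the Killing form of $\mathfrak g$, and also denote by $g_0$ the corresponding bi-invariant Riemannian metric on $G$. Let $K\le G$ be a closed subgroup whose Lie algebra $\mathfrak k$ is semisimple, let $\mathfrak k=\mathfrak k_1\oplus\dots\oplus\mathfrak k_r$ be its decomposition into simple ideals, and let $\mathfrak p$ be the $g_0$-orthogonal complement of $\mathfrak k$ in $\mathfrak g$. Let $\alpha\in\mathbb R$, let $h$ be a bi-invariant Riemannian metric on $K$, and let $g_{\alpha,h}$ be the left-invariant Riemannian metric on $G$ (naturally reductive with respect to $G\times K$) given on $\mathfrak g=\mathfrak p\oplus\mathfrak k$ by the orthogonal direct sum $$g_{\alpha,h}=e^{\alpha}g_0{\restriction}\mathfrak p\ \oplus\ h{\restriction}\mathfrak k .$$ Then there are unique $\alpha_1,\dots,\alpha_r\in\mathbb R$ such that $h=e^{\alpha_1}g_0{\restriction}\mathfrak k_1\oplus\dots\oplus e^{\alpha_r}g_0{\restriction}\mathfrak k_r$ on $\mathfrak k$. Assume that $\alpha_i\ne\alpha$ for all $i$, put $$\beta_i=\frac{e^{\alpha}}{e^{\alpha-\alpha_i}-1}\qquad(1\le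 i\le r),$$ and let $\tilde h$ be the left-invariant field of bilinear forms on $K$ given on $\mathfrak k$ by $\tilde h=\beta_1g_0{\restriction}\mathfrak k_1\oplus\dots\oplus\beta_rg_0{\restriction}\mathfrak k_r$. Then $\tilde h$ is a bi-invariant semi-Riemannian metric on $K$ (a smooth field of symmetric nondegenerate bilinear forms), and the map $$\Phi:(G\times K,\ e^{\alpha}g_0\times\tilde h)\to(G,g_{\alpha,h}),\qquad \Phi(g,k)=gk^{-1},$$ is a semi-Riemannian submersion with totally geodesic fibers. That is, $\Phi$ is a smooth surjective submersion between semi-Riemannian manifolds, the metric of $G\times K$ is nondegenerate on each vertical space $\ker d\Phi_p$, $d\Phi_p$ preserves the scalar products of vectors orthogonal to $\ker d\Phi_p$, and the second fundamental form of each fiber (with respect to the Levi-Civita connection of $e^\alpha g_0\times\tilde h$) vanishes. -/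

import Mathlib

open scoped Manifold ContDiff Topology

noncomputable section

/-- Over `ℝ`, the smoothness needed for the Lie bracket on the Lie algebra of a Lie group is at most
`C^∞`; this makes Mathlib's Lie algebra structure on `GroupLieAlgebra I G` available for
`C^∞` Lie groups. -/
instance leInfty_minSmoothness_three : ENat.LEInfty (minSmoothness ℝ 3) :=
  ⟨by
    rw [minSmoothness_of_isRCLikeNormedField]
    exact ENat.LEInfty.out⟩

namespace SemiRiem

section Metrics

variable {E : Type*} [NormedAddCommGroup E] [NormedSpace ℝ E]
  {H : Type*} [TopologicalSpace H] (I : ModelWithCorners ℝ E H)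
  (M : Type*) [TopologicalSpace M] [ChartedSpace H M]

/-- A field of bilinear forms on the tangent spaces of `M` (no regularity required). -/
abbrev BilinField : Type _ := ∀ x : M, LinearMap.BilinForm ℝ (TangentSpace I x)

variable {I M}

/-- Smoothness of a field of bilinear forms, as a section of the bundle of bilinear forms on `TM`
(same formulation as for Riemannian metrics in Mathlib). -/
def IsSmoothBilinField [IsManifold I 1 M] (q : BilinField I M) : Prop :=
  ∃ Q : ∀ x : M, TangentSpace I x →L[ℝ] TangentSpace I x →L[ℝ] ℝ,
    ContMDiff I (I.prod 𝓘(ℝ, E →L[ℝ] E →L[ℝ] ℝ)) ∞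
      (fun x ↦ Bundle.TotalSpace.mk' (E →L[ℝ] E →L[ℝ] ℝ) x (Q x))
    ∧ ∀ (x : M) (v w : TangentSpace I x), q x v w = Q x v w

/-- A semi-Riemannian metric: a smooth field of symmetric nondegenerate bilinear forms. -/
structure IsSemiRiemannianMetric [IsManifold I 1 M] (q : BilinField I M) : Prop where
  symm : ∀ (x : M) (v w : TangentSpace I x), q x v w = q x w v
  nondegenerate : ∀ x : M, (q x).Nondegenerate
  smooth : IsSmoothBilinField q

/-- A Riemannian metric: a smooth field of symmetric positive definite bilinear forms. -/
structure IsRiemannianMetric [IsManifold I 1 M] (q : BilinField I M) : Prop where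
  symm : ∀ (x : M) (v w : TangentSpace I x), q x v w = q x w v
  pos : ∀ (x : M) (v : TangentSpace I x), v ≠ 0 → 0 < q x v v
  smooth : IsSmoothBilinField q

/-- A connection `cov` on `TM` is a Levi-Civita connection of `q` if it is torsion free and
compatible with `q`, that is `u (q (Y, Z)) = q (∇_u Y, Z) + q (Y, ∇_u Z)`.
Here `cov Y x u` is `∇_u Y` at `x`. -/
structure IsLeviCivita [FiniteDimensional ℝ E] [CompleteSpace E] [IsManifold I 2 M]
    (q : BilinField I M)
    (cov : CovariantDerivative I E (TangentSpace I : M → Type _)) : Prop where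
  torsion_free : cov.torsion = 0
  compatible : ∀ (x : M) (Y Z : ∀ y : M, TangentSpace I y),
    MDiffAt (T% Y) x → MDiffAt (T% Z) x → ∀ u : TangentSpace I x,
      mvfderiv I (fun y ↦ q y (Y y) (Z y)) x u =
        q x (cov Y x u) (Z x) + q x (Y x) (cov Z x u)

end Metrics

section Submersions

variable {E : Type*} [NormedAddCommGroup E] [NormedSpace ℝ E]
  {H : Type*} [TopologicalSpace H] {I : ModelWithCorners ℝ E H}
  {M : Type*} [TopologicalSpace M] [ChartedSpace H M]
  {E' : Type*} [NormedAddCommGroup E'] [NormedSpace ℝ E']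
  {H' : Type*} [TopologicalSpace H'] {J : ModelWithCorners ℝ E' H'}
  {B : Type*} [TopologicalSpace B] [ChartedSpace H' B]

variable (I J) in
/-- The vertical space at `p` of a map `Φ : M → B`, i.e. the tangent space at `p` of the fiber of
`Φ` through `p` when `Φ` is a submersion. -/
def vertical (Φ : M → B) (p : M) : Submodule ℝ (TangentSpace I p) :=
  LinearMap.ker (mfderiv I J Φ p).toLinearMap

/-- A semi-Riemannian submersion `Φ : (M, q) → (B, g)`: a smooth surjective submersion between
semi-Riemannian manifolds whose fibers are nondegenerate (semi-Riemannian submanifolds) and whose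
differential preserves the scalar products of vectors normal to the fibers. -/
structure IsSemiRiemannianSubmersion [IsManifold I 1 M] [IsManifold J 1 B]
    (q : BilinField I M) (g : BilinField J B) (Φ : M → B) : Prop where
  source_metric : IsSemiRiemannianMetric q
  target_metric : IsSemiRiemannianMetric g
  smooth : ContMDiff I J ∞ Φ
  surjective : Function.Surjective Φ
  submersion : ∀ p : M, Function.Surjective (mfderiv I J Φ p)
  nondegenerate_fibers : ∀ p : M, ((q p).restrict (vertical I J Φ p)).Nondegenerate
  isometry_horizontal : ∀ (p : M) (u v : TangentSpace I p),
    (∀ w ∈ vertical I J Φ p, q p u w = 0) → (∀ w ∈ vertical I J Φ p, q p v w = 0) →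
      g (Φ p) (mfderiv I J Φ p u) (mfderiv I J Φ p v) = q p u v

variable (I J) in
/-- The fibers of a submersion `Φ : M → B` are totally geodesic with respect to a connection `cov`
on `TM`: if `u` is tangent at `p` to the fiber of `Φ` through `p`, and the vector field `Y`, smooth
at `p`, is tangent to this fiber along this fiber (near `p`), then `∇_u Y` is tangent to the fiber.
In other words, the second fundamental forms of the fibers vanish. -/
def FibersTotallyGeodesicFor [IsManifold I 2 M]
    (cov : CovariantDerivative I E (TangentSpace I : M → Type _)) (Φ : M → B) : Prop :=
  ∀ p : M, ∀ u ∈ vertical I J Φ p, ∀ Y : ∀ x : M, TangentSpace I x,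
    ContMDiffAt I I.tangent ∞ (T% Y) p →
    (∀ᶠ x in 𝓝 p, Φ x = Φ p → Y x ∈ vertical I J Φ x) →
      cov Y p u ∈ vertical I J Φ p

variable (J) in
/-- The submersion `Φ : (M, q) → B` has totally geodesic fibers, with respect to the Levi-Civita
connection of `q`. (The value of a Levi-Civita connection on differentiable vector fields is
determined by `q`.) -/
def HasTotallyGeodesicFibers [FiniteDimensional ℝ E] [CompleteSpace E] [IsManifold I 2 M]
    (q : BilinField I M) (Φ : M → B) : Prop :=
  ∃ cov : CovariantDerivative I E (TangentSpace I : M → Type _),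
    IsLeviCivita q cov ∧ FibersTotallyGeodesicFor I J cov Φ

/-- The product field of bilinear forms `q × q'` on `M × B`. -/
def prodField (q : BilinField I M) (q' : BilinField J B) : BilinField (I.prod J) (M × B) :=
  fun p ↦
    (q p.1).comp (mfderiv (I.prod J) I Prod.fst p).toLinearMap
        (mfderiv (I.prod J) I Prod.fst p).toLinearMap
      + (q' p.2).comp (mfderiv (I.prod J) J Prod.snd p).toLinearMap
        (mfderiv (I.prod J) J Prod.snd p).toLinearMap

end Submersions

section Groups

variable {E : Type*} [NormedAddCommGroup E] [NormedSpace ℝ E]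
  {H : Type*} [TopologicalSpace H] {I : ModelWithCorners ℝ E H}
  {G : Type*} [TopologicalSpace G] [ChartedSpace H G] [Group G]

/-- Invariance of a field of bilinear forms under left translations. -/
def IsLeftInvariant (q : BilinField I G) : Prop :=
  ∀ (a x : G) (u v : TangentSpace I x),
    q (a * x) (mfderiv I I (fun y ↦ a * y) x u) (mfderiv I I (fun y ↦ a * y) x v) = q x u v

/-- Invariance of a field of bilinear forms under right translations. -/
def IsRightInvariant (q : BilinField I G) : Prop :=
  ∀ (a x : G) (u v : TangentSpace I x),
    q (x * a) (mfderiv I I (fun y ↦ y * a) x u) (mfderiv I I (fun y ↦ y * a) x v) = q x u v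

/-- Invariance under left and right translations. -/
def IsBiInvariant (q : BilinField I G) : Prop := IsLeftInvariant q ∧ IsRightInvariant q

variable (I) in
/-- The differential at `x` of left translation by `x⁻¹`, from `T_x G` to the Lie algebra. -/
def toLieAlgebra (x : G) : TangentSpace I x →ₗ[ℝ] GroupLieAlgebra I G :=
  (mfderiv I I (fun y ↦ x⁻¹ * y) x).toLinearMap

/-- The left-invariant field of bilinear forms with prescribed value on the Lie algebra. -/
def leftInvariantField (b : LinearMap.BilinForm ℝ (GroupLieAlgebra I G)) : BilinField I G :=
  fun x ↦ b.comp (toLieAlgebra I x) (toLieAlgebra I x)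

variable (I G) in
/-- The negative of the Killing form of the Lie algebra of `G`. -/
def negKilling [CompleteSpace E] [LieGroup I ∞ G] :
    LinearMap.BilinForm ℝ (GroupLieAlgebra I G) :=
  -killingForm ℝ (GroupLieAlgebra I G)

variable {E' : Type*} [NormedAddCommGroup E'] [NormedSpace ℝ E']
  {H' : Type*} [TopologicalSpace H']

/-- The given Lie group structure on the subgroup `K`, whose topology is the subspace topology, makes
it an embedded Lie subgroup of `G`: the inclusion is a smooth immersion. -/
structure IsLieSubgroup (I : ModelWithCorners ℝ E H) (J : ModelWithCorners ℝ E' H')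
    (K : Subgroup G) [ChartedSpace H' K] : Prop where
  smooth : ContMDiff J I ∞ (Subtype.val : K → G)
  immersion : ∀ k : K, Function.Injective (mfderiv J I (Subtype.val : K → G) k)

/-- The inclusion of the Lie algebra of a Lie subgroup `K` in the Lie algebra of `G`, that is the
differential at the identity of the inclusion of `K` in `G`. -/
def lieIncl (I : ModelWithCorners ℝ E H) (J : ModelWithCorners ℝ E' H')
    (K : Subgroup G) [ChartedSpace H' K] : GroupLieAlgebra J K →ₗ[ℝ] GroupLieAlgebra I G :=
  (mfderiv J I (Subtype.val : K → G) 1).toLinearMap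

/-- The restriction of the negative of the Killing form of `G` to the Lie algebra of `K`. -/
def negKillingRestrict (I : ModelWithCorners ℝ E H) (J : ModelWithCorners ℝ E' H')
    [CompleteSpace E] [LieGroup I ∞ G] (K : Subgroup G) [ChartedSpace H' K] :
    LinearMap.BilinForm ℝ (GroupLieAlgebra J K) :=
  (negKilling I G).comp (lieIncl I J K) (lieIncl I J K)

/-- The `g₀`-orthogonal complement of the Lie algebra of `K` in the Lie algebra of `G`, where `g₀`
is the negative of the Killing form. -/
def orthComplement (I : ModelWithCorners ℝ E H) (J : ModelWithCorners ℝ E' H')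
    [CompleteSpace E] [LieGroup I ∞ G] (K : Subgroup G) [ChartedSpace H' K] :
    Set (GroupLieAlgebra I G) :=
  {Z | ∀ X : GroupLieAlgebra J K, negKilling I G (lieIncl I J K X) Z = 0}

/-- `g` is the left-invariant metric `g_{α,h}` on `G`, which at the identity is the orthogonal direct
sum of `e^α g₀` on the `g₀`-orthogonal complement of the Lie algebra of `K`, and of `h` on the Lie
algebra of `K`. -/
structure IsMetricOfType {I : ModelWithCorners ℝ E H} {J : ModelWithCorners ℝ E' H'}
    [CompleteSpace E] [LieGroup I ∞ G] {K : Subgroup G} [ChartedSpace H' K]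
    (α : ℝ) (h : BilinField J K) (g : BilinField I G) : Prop where
  leftInvariant : IsLeftInvariant g
  on_subalgebra : ∀ X Y : GroupLieAlgebra J K,
    g 1 (lieIncl I J K X) (lieIncl I J K Y) = h 1 X Y
  on_complement : ∀ Z ∈ orthComplement I J K, ∀ W ∈ orthComplement I J K,
    g 1 Z W = Real.exp α * negKilling I G Z W
  orthogonal : ∀ X : GroupLieAlgebra J K, ∀ Z ∈ orthComplement I J K,
    g 1 (lieIncl I J K X) Z = 0

end Groups

section Algebra

variable {ι V : Type*} [Fintype ι] [DecidableEq ι] [AddCommGroup V] [Module ℝ V]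
  {W : ι → Submodule ℝ V}

/-- The projection of `V` onto the summand `W i` of an internal direct sum decomposition. -/
def summandProj (hW : DirectSum.IsInternal W) (i : ι) : V →ₗ[ℝ] V :=
  (W i).subtype ∘ₗ DirectSum.component ℝ ι (fun j ↦ W j) i ∘ₗ
    (LinearEquiv.ofBijective (DirectSum.coeLinearMap W) hW).symm.toLinearMap

/-- The orthogonal direct sum `⊕ c_i b|W_i` on an internal direct sum `V = ⊕ W_i`. -/
def orthSum (hW : DirectSum.IsInternal W) (c : ι → ℝ) (b : LinearMap.BilinForm ℝ V) :
    LinearMap.BilinForm ℝ V :=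
  ∑ i, c i • b.comp (summandProj hW i) (summandProj hW i)

end Algebra

end SemiRiem

end

open SemiRiem

noncomputable section

namespace SemiRiem

section ChainRule

variable {E : Type*} [NormedAddCommGroup E] [NormedSpace ℝ E]
  {H : Type*} [TopologicalSpace H] {I : ModelWithCorners ℝ E H}
  {M : Type*} [TopologicalSpace M] [ChartedSpace H M]
  {E' : Type*} [NormedAddCommGroup E'] [NormedSpace ℝ E']
  {H' : Type*} [TopologicalSpace H'] {I' : ModelWithCorners ℝ E' H'}
  {M' : Type*} [TopologicalSpace M'] [ChartedSpace H' M']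
  {E'' : Type*} [NormedAddCommGroup E''] [NormedSpace ℝ E'']
  {H'' : Type*} [TopologicalSpace H''] {I'' : ModelWithCorners ℝ E'' H''}
  {M'' : Type*} [TopologicalSpace M''] [ChartedSpace H'' M'']

/-- The chain rule for a map `k` which factors as `g ∘ f`. The tangent spaces are identified with
the model space, so that no transport between tangent spaces at equal points is needed. -/
lemma mfderiv_apply_of_factor {f : M → M'} {g : M' → M''} {k : M → M''} {x : M} {y : M'}
    (hg : MDifferentiableAt I' I'' g y) (hf : MDifferentiableAt I I' f x) (hy : f x = y)
    (hk : ∀ z, k z = g (f z)) (v : TangentSpace I x) :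
    (mfderiv I I'' k x v : E'') = (mfderiv I' I'' g y (mfderiv I I' f x v : E') : E'') := by
  subst hy
  obtain rfl : k = g ∘ f := funext hk
  rw [mfderiv_comp x hg hf]
  rfl

end ChainRule

section LieGroups

variable {E : Type*} [NormedAddCommGroup E] [NormedSpace ℝ E]
  {H : Type*} [TopologicalSpace H] {I : ModelWithCorners ℝ E H}
  {G : Type*} [TopologicalSpace G] [ChartedSpace H G] [Group G]

variable (I) in
/-- The differential at `x` of left translation by `x⁻¹`, as a continuous linear map. -/
def leftTriv (x : G) : TangentSpace I x →L[ℝ] GroupLieAlgebra I G :=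
  mfderiv I I (fun y ↦ x⁻¹ * y) x

variable (I) in
/-- The differential at `1` of left translation by `x`. -/
def leftTrivSymm (x : G) : GroupLieAlgebra I G →L[ℝ] TangentSpace I x :=
  mfderiv I I (fun y ↦ x * y) 1

variable (I) in
/-- The adjoint representation. -/
def Ad (x : G) : GroupLieAlgebra I G →L[ℝ] GroupLieAlgebra I G :=
  mfderiv I I (fun y ↦ x * y * x⁻¹) 1

variable [LieGroup I ∞ G]

lemma mdifferentiableAt_mul_left' (a x : G) : MDifferentiableAt I I (fun y ↦ a * y) x :=
  (contMDiff_mul_left (I := I) (n := ∞)).mdifferentiable (by simp) x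

lemma mdifferentiableAt_mul_right' (a x : G) : MDifferentiableAt I I (fun y ↦ y * a) x :=
  (contMDiff_mul_right (I := I) (n := ∞)).mdifferentiable (by simp) x

lemma contMDiff_conj (a : G) : ContMDiff I I ∞ (fun y : G ↦ a * y * a⁻¹) :=
  (contMDiff_mul_right (I := I) (n := ∞)).comp (contMDiff_mul_left (I := I) (n := ∞))

lemma mdifferentiableAt_conj (a x : G) : MDifferentiableAt I I (fun y ↦ a * y * a⁻¹) x :=
  (contMDiff_conj a).mdifferentiable (by simp) x

omit [Group G] [LieGroup I ∞ G] in
lemma mfderiv_id_of_eq {f : G → G} (hf : ∀ x, f x = x) (x : G) (v : TangentSpace I x) :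
    (mfderiv I I f x v : E) = v := by
  obtain rfl : f = id := funext hf
  rw [mfderiv_id]
  rfl

@[simp]
lemma leftTriv_leftTrivSymm (x : G) (v : GroupLieAlgebra I G) :
    leftTriv I x (leftTrivSymm I x v) = v := by
  have := mfderiv_apply_of_factor (I := I) (I' := I) (I'' := I) (k := fun y : G ↦ y)
    (mdifferentiableAt_mul_left' x⁻¹ x) (mdifferentiableAt_mul_left' x 1) (mul_one x)
    (fun z ↦ by simp) v
  exact this.symm.trans (mfderiv_id_of_eq (fun _ ↦ rfl) _ _)

@[simp]
lemma leftTrivSymm_leftTriv (x : G) (u : TangentSpace I x) :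
    leftTrivSymm I x (leftTriv I x u) = u := by
  have := mfderiv_apply_of_factor (I := I) (I' := I) (I'' := I) (k := fun y : G ↦ y)
    (mdifferentiableAt_mul_left' x 1) (mdifferentiableAt_mul_left' x⁻¹ x) (inv_mul_cancel x)
    (fun z ↦ by simp) u
  exact this.symm.trans (mfderiv_id_of_eq (fun _ ↦ rfl) _ _)

lemma leftTriv_mul_left (a x : G) (u : TangentSpace I x) :
    leftTriv I (a * x) (mfderiv I I (fun y ↦ a * y) x u) = leftTriv I x u :=
  (mfderiv_apply_of_factor (I := I) (I' := I) (I'' := I) (k := fun y : G ↦ x⁻¹ * y)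
    (mdifferentiableAt_mul_left' (a * x)⁻¹ (a * x)) (mdifferentiableAt_mul_left' a x) rfl
    (fun z ↦ by group) u).symm

lemma leftTriv_mul_right (a x : G) (u : TangentSpace I x) :
    leftTriv I (x * a) (mfderiv I I (fun y ↦ y * a) x u) = Ad I a⁻¹ (leftTriv I x u) := by
  have h1 := mfderiv_apply_of_factor (I := I) (I' := I) (I'' := I)
    (k := fun y : G ↦ a⁻¹ * (x⁻¹ * y) * a⁻¹⁻¹)
    (mdifferentiableAt_mul_left' (x * a)⁻¹ (x * a)) (mdifferentiableAt_mul_right' a x) rfl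
    (fun z ↦ by group) u
  have h2 := mfderiv_apply_of_factor (I := I) (I' := I) (I'' := I)
    (k := fun y : G ↦ a⁻¹ * (x⁻¹ * y) * a⁻¹⁻¹)
    (mdifferentiableAt_conj a⁻¹ 1) (mdifferentiableAt_mul_left' x⁻¹ x) (inv_mul_cancel x)
    (fun z ↦ rfl) u
  exact h1.symm.trans h2

omit [LieGroup I ∞ G] in
@[simp]
lemma leftTriv_one (u : GroupLieAlgebra I G) : leftTriv I (1 : G) u = u :=
  mfderiv_id_of_eq (fun _ ↦ by simp) _ _

omit [LieGroup I ∞ G] in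
lemma Ad_one (v : GroupLieAlgebra I G) : Ad I (1 : G) v = v :=
  mfderiv_id_of_eq (fun _ ↦ by simp) _ _

lemma Ad_mul (x y : G) (v : GroupLieAlgebra I G) : Ad I (x * y) v = Ad I x (Ad I y v) :=
  mfderiv_apply_of_factor (I := I) (I' := I) (I'' := I)
    (k := fun z : G ↦ (x * y) * z * (x * y)⁻¹)
    (mdifferentiableAt_conj x 1) (mdifferentiableAt_conj y 1) (by simp)
    (fun z ↦ by group) v

lemma Ad_inv_Ad (x : G) (v : GroupLieAlgebra I G) : Ad I x⁻¹ (Ad I x v) = v := by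
  rw [← Ad_mul, inv_mul_cancel, Ad_one]

lemma Ad_Ad_inv (x : G) (v : GroupLieAlgebra I G) : Ad I x (Ad I x⁻¹ v) = v := by
  rw [← Ad_mul, mul_inv_cancel, Ad_one]

variable {E' : Type*} [NormedAddCommGroup E'] [NormedSpace ℝ E']
  {H' : Type*} [TopologicalSpace H'] {J : ModelWithCorners ℝ E' H'}
  {K : Type*} [TopologicalSpace K] [ChartedSpace H' K] [Group K] [LieGroup J ∞ K]

variable (I J) in
/-- The differential at the identity of a homomorphism of Lie groups. -/
def homDeriv (φ : K →* G) : GroupLieAlgebra J K →L[ℝ] GroupLieAlgebra I G :=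
  mfderiv J I φ 1

lemma homDeriv_Ad (φ : K →* G) (hφ : MDifferentiable J I φ) (x : K) (v : GroupLieAlgebra J K) :
    homDeriv I J φ (Ad J x v) = Ad I (φ x) (homDeriv I J φ v) := by
  have h1 := mfderiv_apply_of_factor (I := J) (I' := J) (I'' := I)
    (k := fun y : K ↦ φ (x * y * x⁻¹))
    (hφ 1) (mdifferentiableAt_conj x 1) (by simp) (fun z ↦ rfl) v
  have h2 := mfderiv_apply_of_factor (I := J) (I' := I) (I'' := I)
    (k := fun y : K ↦ φ (x * y * x⁻¹))
    (mdifferentiableAt_conj (φ x) 1) (hφ 1) (by simp) (fun z ↦ by simp) v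
  exact h1.symm.trans h2

lemma leftTriv_hom (φ : K →* G) (hφ : MDifferentiable J I φ) (x : K) (u : TangentSpace J x) :
    leftTriv I (φ x) (mfderiv J I φ x u) = homDeriv I J φ (leftTriv J x u) := by
  have h1 := mfderiv_apply_of_factor (I := J) (I' := J) (I'' := I)
    (k := fun y : K ↦ φ (x⁻¹ * y))
    (hφ 1) (mdifferentiableAt_mul_left' x⁻¹ x) (by simp) (fun z ↦ rfl) u
  have h2 := mfderiv_apply_of_factor (I := J) (I' := I) (I'' := I)
    (k := fun y : K ↦ φ (x⁻¹ * y))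
    (mdifferentiableAt_mul_left' (φ x)⁻¹ (φ x)) (hφ x) rfl (fun z ↦ by simp) u
  exact h2.symm.trans h1

end LieGroups

section Smoothness

variable {E : Type*} [NormedAddCommGroup E] [NormedSpace ℝ E]
  {H : Type*} [TopologicalSpace H] {I : ModelWithCorners ℝ E H}
  {G : Type*} [TopologicalSpace G] [ChartedSpace H G] [Group G]

variable (I) in
/-- The map `leftTriv`, with values in the model space. -/
def leftTrivModel (x : G) : TangentSpace I x →L[ℝ] E := leftTriv I x

variable (I) in
/-- The adjoint representation, on the model space. -/
def AdModel (x : G) : E →L[ℝ] E := Ad I x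

lemma coordChange_achart_self {M : Type*} [TopologicalSpace M] [ChartedSpace H M]
    [IsManifold I 1 M] (x : M) :
    (tangentBundleCore I M).coordChange (achart H x) (achart H x) x =
      ContinuousLinearMap.id ℝ E := by
  ext v
  exact (tangentBundleCore I M).coordChange_self _ _ (by simp) _

variable [LieGroup I ∞ G]

variable (I G) in
lemma contMDiff_AdModel : ContMDiff I 𝓘(ℝ, E →L[ℝ] E) ∞ (fun x : G ↦ AdModel I x) := by
  intro x₀
  have hf : ContMDiff (I.prod I) I ∞ (Function.uncurry fun x y : G ↦ x * y * x⁻¹) :=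
    (contMDiff_fst.mul contMDiff_snd).mul contMDiff_fst.inv
  have h := ContMDiffAt.mfderiv (m := ∞) (fun x y : G ↦ x * y * x⁻¹) (fun _ ↦ (1 : G))
    hf.contMDiffAt (x₀ := x₀) contMDiffAt_const (by simp)
  refine h.congr_of_eventuallyEq (Filter.Eventually.of_forall fun x ↦ ?_)
  have e : x * 1 * x⁻¹ = 1 := by simp
  have e₀ : x₀ * 1 * x₀⁻¹ = 1 := by simp
  have key := inTangentCoordinates_eq (I := I) (I' := I) (fun _ ↦ (1 : G)) (fun x : G ↦ x * 1 * x⁻¹)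
    (AdModel I) (x₀ := x₀) (x := x) (by simp) (by simp)
  simp only [e, e₀, coordChange_achart_self, ContinuousLinearMap.id_comp,
    ContinuousLinearMap.comp_id] at key
  exact key.symm

variable (I) in
lemma contMDiffAt_leftTriv_comp_symmL (x₀ : G) :
    ContMDiffAt I 𝓘(ℝ, E →L[ℝ] E) ∞ (fun x : G ↦
      leftTrivModel I x ∘L (trivializationAt E (TangentSpace I) x₀).symmL ℝ x) x₀ := by
  have hf : ContMDiff (I.prod I) I ∞ (Function.uncurry fun x y : G ↦ x⁻¹ * y) :=
    contMDiff_fst.inv.mul contMDiff_snd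
  have h := ContMDiffAt.mfderiv (m := ∞) (fun x y : G ↦ x⁻¹ * y) id
    hf.contMDiffAt (x₀ := x₀) contMDiffAt_id (by simp)
  refine h.congr_of_eventuallyEq ?_
  filter_upwards [(chartAt H x₀).open_source.mem_nhds (mem_chart_source H x₀)] with x hx
  have e : x⁻¹ * x = 1 := by simp
  have e₀ : x₀⁻¹ * x₀ = 1 := by simp
  have key := inTangentCoordinates_eq (I := I) (I' := I) id (fun x : G ↦ x⁻¹ * x)
    (leftTrivModel I) (x₀ := x₀) (x := x) hx (by simp)
  simp only [e, e₀, coordChange_achart_self, ContinuousLinearMap.id_comp, id] at key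
  rw [TangentBundle.symmL_trivializationAt_eq_core hx]
  exact key.symm

variable (I G) in
lemma contMDiff_leftTrivModel :
    ContMDiff I (I.prod 𝓘(ℝ, E →L[ℝ] E)) ∞ (fun x : G ↦
      Bundle.TotalSpace.mk' (E →L[ℝ] E)
        (E := fun x : G ↦ TangentSpace I x →L[ℝ] Bundle.Trivial G E x) x (leftTrivModel I x)) := by
  intro x₀
  rw [contMDiffAt_hom_bundle]
  refine ⟨contMDiffAt_id, (contMDiffAt_leftTriv_comp_symmL I x₀).congr_of_eventuallyEq ?_⟩
  exact Filter.Eventually.of_forall fun x ↦ by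
    ext v
    simp [ContinuousLinearMap.inCoordinates]

lemma mdifferentiableAt_leftTriv_apply {Y : ∀ x : G, TangentSpace I x} {x : G}
    (hY : MDiffAt (T% Y) x) :
    MDifferentiableAt I 𝓘(ℝ, E) (fun y ↦ leftTrivModel I y (Y y)) x := by
  have h1 := ((contMDiff_leftTrivModel I G).mdifferentiable (by simp)) x
  have h := MDifferentiableAt.clm_bundle_apply (E₂ := Bundle.Trivial G E)
    (b := fun y : G ↦ y) h1 hY
  exact ((mdifferentiableAt_section (E := Bundle.Trivial G E) I _).1 h)

lemma mdifferentiable_Ad_inv_apply (v : E) :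
    MDifferentiable I 𝓘(ℝ, E) (fun x : G ↦ AdModel I x⁻¹ v) := by
  have h : ContMDiff I 𝓘(ℝ, E →L[ℝ] E) ∞ (fun x : G ↦ AdModel I x⁻¹) :=
    (contMDiff_AdModel I G).comp (contMDiff_inv I ∞)
  exact (h.clm_apply contMDiff_const).mdifferentiable (by simp)

lemma continuous_Ad_apply (v : E) : Continuous (fun x : G ↦ AdModel I x v) :=
  ((contMDiff_AdModel I G).clm_apply contMDiff_const).continuous

variable [FiniteDimensional ℝ E]

/-- A bilinear form on the Lie algebra, as a continuous bilinear form on the model space. -/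
def bilinL (b : LinearMap.BilinForm ℝ (GroupLieAlgebra I G)) : E →L[ℝ] E →L[ℝ] ℝ :=
  LinearMap.toContinuousLinearMap
    ((LinearMap.toContinuousLinearMap (𝕜 := ℝ) (E := E) (F' := ℝ)).toLinearMap ∘ₗ
      (b : E →ₗ[ℝ] E →ₗ[ℝ] ℝ))

lemma isSmoothBilinField_leftInvariantField (b : LinearMap.BilinForm ℝ (GroupLieAlgebra I G)) :
    IsSmoothBilinField (leftInvariantField b) := by
  have hΘ := contMDiffAt_leftTriv_comp_symmL (G := G) I
  refine ⟨fun x ↦ ContinuousLinearMap.precomp ℝ (leftTrivModel I x) ∘L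
    (bilinL b ∘L leftTrivModel I x), ?_, fun x v w ↦ rfl⟩
  intro x₀
  rw [contMDiffAt_hom_bundle]
  refine ⟨contMDiffAt_id, ?_⟩
  have h1 : ContMDiffAt I 𝓘(ℝ, E →L[ℝ] E →L[ℝ] ℝ) ∞ (fun x : G ↦
      ((leftTrivModel I x ∘L (trivializationAt E (TangentSpace I) x₀).symmL ℝ x).precomp ℝ)
        ∘L ((bilinL b) ∘L
          (leftTrivModel I x ∘L (trivializationAt E (TangentSpace I) x₀).symmL ℝ x))) x₀ :=
    ContMDiffAt.clm_comp (hΘ x₀).clm_precomp (contMDiffAt_const.clm_comp (hΘ x₀))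
  refine h1.congr_of_eventuallyEq ?_
  filter_upwards [(chartAt H x₀).open_source.mem_nhds (mem_chart_source H x₀)] with x hx
  ext v w
  refine (inCoordinates_apply_eq₂ hx hx (Set.mem_univ _)).trans ?_
  simp only [Bundle.Trivial.fiberBundle_trivializationAt',
    Bundle.Trivial.linearMapAt_trivialization, LinearMap.id_coe, id_eq]
  simp [(trivializationAt E (TangentSpace I) x₀).symmL_apply (R := ℝ) (b := x) hx]

end Smoothness

section Commute

variable {E : Type*} [NormedAddCommGroup E] [NormedSpace ℝ E]

/-- The symmetry of mixed second derivatives. -/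
lemma fderiv_fderiv_comm {m : E × E → E} {a : E} (hm : ContDiffAt ℝ 2 m (a, a)) (v w : E) :
    fderiv ℝ (fun x ↦ fderiv ℝ (fun y ↦ m (x, y)) a w) a v =
      fderiv ℝ (fun y ↦ fderiv ℝ (fun x ↦ m (x, y)) a v) a w := by
  have hd : ∀ᶠ p in 𝓝 (a, a), DifferentiableAt ℝ m p := by
    filter_upwards [hm.eventually (by simp)] with p hp using hp.differentiableAt (by simp)
  have hd2 : DifferentiableAt ℝ (fderiv ℝ m) (a, a) :=
    (hm.fderiv_right (m := 1) (by norm_num)).differentiableAt (by simp)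
  have e1 : (fun x ↦ fderiv ℝ (fun y ↦ m (x, y)) a w) =ᶠ[𝓝 a]
      fun x ↦ fderiv ℝ m (x, a) (0, w) := by
    have : Filter.Tendsto (fun x : E ↦ (x, a)) (𝓝 a) (𝓝 (a, a)) :=
      (Continuous.prodMk_left a).tendsto a
    filter_upwards [this.eventually hd] with x hx
    have := hx.hasFDerivAt.comp a (hasFDerivAt_prodMk_right (𝕜 := ℝ) x a)
    exact congr($(this.fderiv) w)
  have e2 : (fun y ↦ fderiv ℝ (fun x ↦ m (x, y)) a v) =ᶠ[𝓝 a]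
      fun y ↦ fderiv ℝ m (a, y) (v, 0) := by
    have : Filter.Tendsto (fun y : E ↦ (a, y)) (𝓝 a) (𝓝 (a, a)) :=
      (Continuous.prodMk_right a).tendsto a
    filter_upwards [this.eventually hd] with y hy
    have := hy.hasFDerivAt.comp a (hasFDerivAt_prodMk_left (𝕜 := ℝ) a y)
    exact congr($(this.fderiv) v)
  rw [e1.fderiv_eq, e2.fderiv_eq]
  have h1 := (HasFDerivAt.comp (f := fun x ↦ (x, a)) a hd2.hasFDerivAt
    (hasFDerivAt_prodMk_left (𝕜 := ℝ) a a)).clm_apply (hasFDerivAt_const ((0, w) : E × E) a)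
  have h2 := (HasFDerivAt.comp (f := fun x ↦ (a, x)) a hd2.hasFDerivAt
    (hasFDerivAt_prodMk_right (𝕜 := ℝ) a a)).clm_apply (hasFDerivAt_const ((v, 0) : E × E) a)
  have h1' := congr($(h1.fderiv) v)
  have h2' := congr($(h2.fderiv) w)
  simp only [Function.comp_def] at h1' h2'
  rw [h1', h2']
  have := (hm.isSymmSndFDerivAt (by simp)) (v, 0) (0, w)
  simpa using this

lemma lieBracketWithin_eq_zero_of_mixed {m : E × E → E} {a w w' : E}
    (hm : ContDiffAt ℝ 2 m (a, a)) {V W : E → E}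
    (hV : V =ᶠ[𝓝 a] fun x ↦ fderiv ℝ (fun y ↦ m (x, y)) a w)
    (hW : W =ᶠ[𝓝 a] fun x ↦ fderiv ℝ (fun y ↦ m (y, x)) a w')
    (hVa : V a = w) (hWa : W a = w') :
    VectorField.lieBracketWithin ℝ V W Set.univ a = 0 := by
  rw [VectorField.lieBracketWithin_univ, VectorField.lieBracket_eq]
  simp only [hVa, hWa]
  rw [hV.fderiv_eq, hW.fderiv_eq, fderiv_fderiv_comm hm, sub_self]

variable {H : Type*} [TopologicalSpace H] {I : ModelWithCorners ℝ E H}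
  {G : Type*} [TopologicalSpace G] [ChartedSpace H G] [Group G] [LieGroup I ∞ G]

/-- The right-invariant vector field with value `v` at the identity. -/
def rightInvariantVectorField (v : GroupLieAlgebra I G) (x : G) : TangentSpace I x :=
  mfderiv I I (fun y ↦ y * x) 1 v

variable [I.Boundaryless]

lemma inverse_mfderivWithin_extChartAt_symm {F : G → G} (hF : MDifferentiableAt I I F 1) {x : E}
    (hx : x ∈ (extChartAt I (1 : G)).target) (hFx : F 1 = (extChartAt I (1 : G)).symm x)
    (X : GroupLieAlgebra I G) :
    ((mfderivWithin 𝓘(ℝ, E) I (extChartAt I (1 : G)).symm (Set.range I) x).inverse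
      (mfderiv I I F 1 X : E) : E) =
    fderiv ℝ (fun y ↦ extChartAt I (1 : G) (F ((extChartAt I (1 : G)).symm y)))
      (extChartAt I (1 : G) 1) (mfderiv I 𝓘(ℝ, E) (extChartAt I (1 : G)) 1 X : E) := by
  set φ := extChartAt I (1 : G) with hφ
  have hz : φ.symm x ∈ φ.source := φ.map_target hx
  have hz' : φ.symm x ∈ (chartAt H (1 : G)).source := by rwa [← extChartAt_source (I := I)]
  have h1 : (1 : G) ∈ φ.source := mem_extChartAt_source 1
  have hsymm : MDifferentiableAt 𝓘(ℝ, E) I φ.symm (φ 1) := by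
    have := mdifferentiableWithinAt_extChartAt_symm (I := I) (φ.map_source h1)
    rwa [I.range_eq_univ, mdifferentiableWithinAt_univ] at this
  have hinv : (mfderivWithin 𝓘(ℝ, E) I φ.symm (Set.range I) x).inverse =
      mfderiv I 𝓘(ℝ, E) φ (φ.symm x) :=
    ContinuousLinearMap.inverse_eq
      (mfderivWithin_extChartAt_symm_comp_mfderiv_extChartAt hx)
      (mfderiv_extChartAt_comp_mfderivWithin_extChartAt_symm hx)
  have hid : (mfderiv 𝓘(ℝ, E) I φ.symm (φ 1) (mfderiv I 𝓘(ℝ, E) φ 1 X)) = X := by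
    have := mfderivWithin_extChartAt_symm_comp_mfderiv_extChartAt' (I := I) h1
    rw [I.range_eq_univ, mfderivWithin_univ] at this
    exact congr($this X)
  have hFs : MDifferentiableAt 𝓘(ℝ, E) I (fun y ↦ F (φ.symm y)) (φ 1) :=
    hF.comp_of_eq (f := φ.symm) _ hsymm (φ.left_inv h1)
  have c1 := mfderiv_apply_of_factor (I := 𝓘(ℝ, E)) (I' := I) (I'' := 𝓘(ℝ, E))
    (k := fun y ↦ φ (F (φ.symm y))) (mdifferentiableAt_extChartAt hz') hFs
    (by rw [φ.left_inv h1, hFx]) (fun _ ↦ rfl) (mfderiv I 𝓘(ℝ, E) φ 1 X)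
  have c2 := mfderiv_apply_of_factor (I := 𝓘(ℝ, E)) (I' := I) (I'' := I)
    (k := fun y ↦ F (φ.symm y)) hF hsymm (φ.left_inv h1) (fun _ ↦ rfl)
    (mfderiv I 𝓘(ℝ, E) φ 1 X)
  rw [hinv, ← mfderiv_eq_fderiv]
  refine Eq.trans ?_ c1.symm
  refine congrArg (mfderiv I 𝓘(ℝ, E) φ (φ.symm x)) ?_
  refine Eq.trans ?_ c2.symm
  exact congrArg (mfderiv I I F 1) hid.symm

lemma mlieBracket_mulInvariant_rightInvariant (X v : GroupLieAlgebra I G) :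
    VectorField.mlieBracket I (mulInvariantVectorField X) (rightInvariantVectorField v) (1 : G)
      = 0 := by
  set φ := extChartAt I (1 : G) with hφ
  set a := φ 1 with ha
  let m : E × E → E := fun p ↦ φ (φ.symm p.1 * φ.symm p.2)
  have hm : ContDiffAt ℝ 2 m (a, a) := by
    have h1 : (1 : G) ∈ φ.source := mem_extChartAt_source 1
    have hs : ContMDiffAt 𝓘(ℝ, E) I ∞ φ.symm a :=
      (contMDiffOn_extChartAt_symm (1 : G)).contMDiffAt (extChartAt_target_mem_nhds 1)
    have e : φ.symm a = 1 := φ.left_inv h1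
    have hmul : ContMDiffAt 𝓘(ℝ, E × E) I ∞ (fun p : E × E ↦ φ.symm p.1 * φ.symm p.2) (a, a) :=
      (ContMDiffAt.comp (a, a) hs contDiff_fst.contMDiff.contMDiffAt).mul
        (ContMDiffAt.comp (a, a) hs contDiff_snd.contMDiff.contMDiffAt)
    have := (contMDiffAt_extChartAt (I := I) (n := ∞) (x := (1 : G))).comp_of_eq hmul
      (by simp [e])
    exact (contMDiffAt_iff_contDiffAt.1 this).of_le ENat.LEInfty.out
  rw [← VectorField.mlieBracketWithin_univ, VectorField.mlieBracketWithin_apply]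
  set V := VectorField.mpullbackWithin 𝓘(ℝ, E) I φ.symm (mulInvariantVectorField X) (Set.range I)
  set W := VectorField.mpullbackWithin 𝓘(ℝ, E) I φ.symm (rightInvariantVectorField v) (Set.range I)
  set w : E := (mfderiv I 𝓘(ℝ, E) φ 1 X : E)
  set w' : E := (mfderiv I 𝓘(ℝ, E) φ 1 v : E)
  have hV : ∀ x ∈ φ.target, V x = fderiv ℝ (fun y ↦ m (x, y)) a w := by
    intro x hx
    exact inverse_mfderivWithin_extChartAt_symm (mdifferentiableAt_mul_left' (φ.symm x) 1) hx
      (mul_one _) X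
  have hW : ∀ x ∈ φ.target, W x = fderiv ℝ (fun y ↦ m (y, x)) a w' := by
    intro x hx
    exact inverse_mfderivWithin_extChartAt_symm (mdifferentiableAt_mul_right' (φ.symm x) 1) hx
      (one_mul _) v
  have hat : φ.target ∈ 𝓝 a := extChartAt_target_mem_nhds 1
  have ha' : φ.symm a = 1 := φ.left_inv (mem_extChartAt_source 1)
  have hid : ∀ {f : E → E} (u : E), (∀ y ∈ φ.target, f y = y) → fderiv ℝ f a u = u := by
    intro f u hf
    have : f =ᶠ[𝓝 a] id := by filter_upwards [hat] with y hy using hf y hy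
    rw [this.fderiv_eq, fderiv_id]
    rfl
  have hVa : V a = w := (hV a (mem_of_mem_nhds hat)).trans
    (hid w fun y hy ↦ by simp [m, ha', φ.right_inv hy])
  have hWa : W a = w' := (hW a (mem_of_mem_nhds hat)).trans
    (hid w' fun y hy ↦ by simp [m, ha', φ.right_inv hy])
  have hV' : V =ᶠ[𝓝 a] fun x ↦ fderiv ℝ (fun y ↦ m (x, y)) a w := by
    filter_upwards [hat] with x hx using hV x hx
  have hW' : W =ᶠ[𝓝 a] fun x ↦ fderiv ℝ (fun y ↦ m (y, x)) a w' := by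
    filter_upwards [hat] with x hx using hW x hx
  have key := lieBracketWithin_eq_zero_of_mixed hm hV' hW' hVa hWa
  simp only [Set.preimage_univ, Set.univ_inter, I.range_eq_univ]
  exact (congrArg _ key).trans (map_zero _)

end Commute

section Connection

variable {E : Type*} [NormedAddCommGroup E] [NormedSpace ℝ E]
  {H : Type*} [TopologicalSpace H] {I : ModelWithCorners ℝ E H}
  {G : Type*} [TopologicalSpace G] [ChartedSpace H G] [Group G]

variable (I) in
/-- The map `leftTrivSymm`, defined on the model space. -/
def leftTrivSymmModel (x : G) : E →L[ℝ] TangentSpace I x := leftTrivSymm I x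

lemma leftTrivModel_mulInvariantVectorField [LieGroup I ∞ G] (v : E) (x : G) :
    leftTrivModel I x (mulInvariantVectorField (I := I) (G := G) v x) = v :=
  leftTriv_leftTrivSymm x v

@[simp]
lemma leftTrivModel_leftTrivSymmModel [LieGroup I ∞ G] (v : E) (x : G) :
    leftTrivModel I x (leftTrivSymmModel I x v) = v :=
  leftTriv_leftTrivSymm x v

@[simp]
lemma leftTrivSymmModel_leftTrivModel [LieGroup I ∞ G] (x : G) (u : TangentSpace I x) :
    leftTrivSymmModel I x (leftTrivModel I x u) = u :=
  leftTrivSymm_leftTriv x u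

variable (I G) in
/-- The flat connection for which the left-invariant vector fields are parallel. -/
def leftFlatCov [LieGroup I ∞ G] : CovariantDerivative I E (TangentSpace I : G → Type _) where
  toFun Y x := leftTrivSymmModel I x ∘L mvfderiv I (fun y ↦ leftTrivModel I y (Y y)) x
  isCovariantDerivativeOnUniv :=
    { add := by
        intro σ σ' x hσ hσ' _
        have : (fun y ↦ leftTrivModel I y ((σ + σ') y)) =
            (fun y ↦ leftTrivModel I y (σ y)) + fun y ↦ leftTrivModel I y (σ' y) := by
          ext y; simp
        rw [this, mvfderiv_add (mdifferentiableAt_leftTriv_apply hσ)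
          (mdifferentiableAt_leftTriv_apply hσ'), ContinuousLinearMap.comp_add]
      leibniz := by
        intro σ g x hσ hg _
        have : (fun y ↦ leftTrivModel I y ((g • σ) y)) =
            g • fun y ↦ leftTrivModel I y (σ y) := by
          ext y; simp
        rw [this, mvfderiv_smul hg (mdifferentiableAt_leftTriv_apply hσ)]
        ext u
        simp }

lemma leftFlatCov_apply [LieGroup I ∞ G] (Y : ∀ x : G, TangentSpace I x) (x : G)
    (u : TangentSpace I x) : leftFlatCov I G Y x u =
      leftTrivSymmModel I x (mvfderiv I (fun y ↦ leftTrivModel I y (Y y)) x u) := rfl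

lemma leftFlatCov_mulInvariantVectorField [LieGroup I ∞ G] (v : GroupLieAlgebra I G) (x : G)
    (u : TangentSpace I x) : leftFlatCov I G (mulInvariantVectorField v) x u = 0 := by
  have : (fun y : G ↦ leftTrivModel I y (mulInvariantVectorField v y)) = fun _ ↦ (v : E) :=
    funext fun y ↦ leftTrivModel_mulInvariantVectorField (E := E) v y
  rw [leftFlatCov_apply, this]
  erw [mvfderiv_const]
  simp

variable [LieGroup I ∞ G]

lemma leftTrivModel_rightInvariantVectorField (v : GroupLieAlgebra I G) (x : G) :
    leftTrivModel I x (rightInvariantVectorField v x) = AdModel I x⁻¹ (v : E) := by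
  exact (mfderiv_apply_of_factor (I := I) (I' := I) (I'' := I)
    (k := fun y : G ↦ x⁻¹ * y * x⁻¹⁻¹)
    (mdifferentiableAt_mul_left' x⁻¹ x) (mdifferentiableAt_mul_right' x 1) (one_mul x)
    (fun z ↦ by group) v).symm

omit [LieGroup I ∞ G] in
lemma leftTrivSymmModel_one (v : E) : leftTrivSymmModel I (1 : G) v = v :=
  mfderiv_id_of_eq (fun _ ↦ by simp) _ _

lemma mdifferentiableAt_rightInvariantVectorField (v : GroupLieAlgebra I G) (x₀ : G) :
    MDiffAt (T% (rightInvariantVectorField (I := I) (G := G) v)) x₀ := by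
  have hf : ContMDiff (I.prod I) I ∞ (Function.uncurry fun x y : G ↦ y * x) :=
    contMDiff_snd.mul contMDiff_fst
  have h := ContMDiffAt.mfderiv (m := ∞) (fun x y : G ↦ y * x) (fun _ ↦ (1 : G))
    hf.contMDiffAt (x₀ := x₀) contMDiffAt_const (by simp)
  simp only [one_mul] at h
  have := ContMDiffAt.clm_apply_of_inCoordinates (b₁ := fun _ : G ↦ (1 : G)) (b₂ := fun x : G ↦ x)
    (IB₁ := I) (IB₂ := I) (E₁ := (TangentSpace I : G → Type _))
    (E₂ := (TangentSpace I : G → Type _)) (F₁ := E) (F₂ := E)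
    (ϕ := fun x ↦ (mfderiv I I (fun y : G ↦ y * x) 1 :)) (v := fun _ ↦ v) h
    contMDiffAt_const contMDiffAt_id
  exact this.mdifferentiableAt (by simp)

variable [FiniteDimensional ℝ E] [CompleteSpace E]

lemma leftFlatCov_torsion (x : G) (u v : GroupLieAlgebra I G) :
    (leftFlatCov I G).torsion x (mulInvariantVectorField u x) (mulInvariantVectorField v x) =
      -mulInvariantVectorField ⁅u, v⁆ x := by
  rw [CovariantDerivative.torsion_apply]
  · simp [leftFlatCov_mulInvariantVectorField, GroupLieAlgebra.bracket_def,
      mulInvariantVector_mlieBracket]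
  · exact mdifferentiableAt_mulInvariantVectorField _
  · exact mdifferentiableAt_mulInvariantVectorField _

variable [I.Boundaryless]

/-- The differential at the identity of the adjoint representation is the bracket. -/
lemma mvfderiv_Ad_inv (X v : GroupLieAlgebra I G) :
    mvfderiv I (fun x : G ↦ AdModel I x⁻¹ v) 1 X = (-⁅X, v⁆ : GroupLieAlgebra I G) := by
  have hX : mulInvariantVectorField X (1 : G) = X := leftTrivSymmModel_one (E := E) X
  have hv : mulInvariantVectorField v (1 : G) = v := leftTrivSymmModel_one (E := E) v
  have hXv : mulInvariantVectorField ⁅X, v⁆ (1 : G) = ⁅X, v⁆ := leftTrivSymmModel_one (E := E) _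
  have hR : rightInvariantVectorField v (1 : G) = v := mfderiv_id_of_eq (fun _ ↦ by simp) _ _
  have hRd : MDiffAt (T% (rightInvariantVectorField (I := I) (G := G) v)) 1 := by
    exact mdifferentiableAt_rightInvariantVectorField v 1
  have h1 := leftFlatCov_torsion (1 : G) X v
  have h2 := (leftFlatCov I G).torsion_apply (x := (1 : G))
    (mdifferentiableAt_mulInvariantVectorField X) hRd
  rw [mlieBracket_mulInvariant_rightInvariant, leftFlatCov_mulInvariantVectorField, hX, hR] at h2
  rw [hX, hv, h2, hXv] at h1
  rw [sub_zero, sub_zero, leftFlatCov_apply, leftTrivSymmModel_one] at h1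
  rw [← h1]
  congr
  funext y
  exact (leftTrivModel_rightInvariantVectorField v y).symm

end Connection

section VectorValued

variable {E : Type*} [NormedAddCommGroup E] [NormedSpace ℝ E]
  {H : Type*} [TopologicalSpace H] {I : ModelWithCorners ℝ E H}
  {M : Type*} [TopologicalSpace M] [ChartedSpace H M]
  {F₁ F₂ F₃ : Type*} [NormedAddCommGroup F₁] [NormedSpace ℝ F₁] [NormedAddCommGroup F₂]
  [NormedSpace ℝ F₂] [NormedAddCommGroup F₃] [NormedSpace ℝ F₃]

lemma mvfderiv_clm_comp (L : F₁ →L[ℝ] F₂) {f : M → F₁} {x : M}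
    (hf : MDifferentiableAt I 𝓘(ℝ, F₁) f x) (u : TangentSpace I x) :
    mvfderiv I (fun y ↦ L (f y)) x u = L (mvfderiv I f x u) := by
  have h := (L.hasFDerivAt (x := f x)).hasMFDerivAt.comp x hf.hasMFDerivAt
  exact congr($(h.mfderiv) u)

lemma mvfderiv_bilin (B : F₁ →L[ℝ] F₂ →L[ℝ] F₃) {f : M → F₁} {g : M → F₂} {x : M}
    (hf : MDifferentiableAt I 𝓘(ℝ, F₁) f x) (hg : MDifferentiableAt I 𝓘(ℝ, F₂) g x)
    (u : TangentSpace I x) :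
    mvfderiv I (fun y ↦ B (f y) (g y)) x u =
      B (mvfderiv I f x u) (g x) + B (f x) (mvfderiv I g x u) := by
  have h1 : HasFDerivAt (fun p : F₁ × F₂ ↦ B p.1 p.2) (B.deriv₂ (f x, g x)) (f x, g x) :=
    B.isBoundedBilinearMap.hasFDerivAt (f x, g x)
  have h2 : HasMFDerivAt I 𝓘(ℝ, F₁ × F₂) (fun y ↦ (f y, g y)) x
      ((mfderiv I 𝓘(ℝ, F₁) f x).prod (mfderiv I 𝓘(ℝ, F₂) g x)) :=
    ⟨hf.hasMFDerivAt.1.prodMk hg.hasMFDerivAt.1, hf.hasMFDerivAt.2.prodMk hg.hasMFDerivAt.2⟩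
  have h := HasMFDerivAt.comp (f := fun y ↦ (f y, g y)) x h1.hasMFDerivAt h2
  rw [add_comm]
  exact congr($(h.mfderiv) u)

lemma mvfderiv_comp_of_eq' {E' : Type*} [NormedAddCommGroup E'] [NormedSpace ℝ E']
    {H' : Type*} [TopologicalSpace H'] {I' : ModelWithCorners ℝ E' H'}
    {N : Type*} [TopologicalSpace N] [ChartedSpace H' N] {f : N → M} {g : M → F₁} {x : N} {y : M}
    (hg : MDifferentiableAt I 𝓘(ℝ, F₁) g y) (hf : MDifferentiableAt I' I f x) (hy : f x = y)
    (u : TangentSpace I' x) :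
    mvfderiv I' (fun z ↦ g (f z)) x u = mvfderiv I g y (mfderiv I' I f x u : E) :=
  mfderiv_apply_of_factor hg hf hy (fun _ ↦ rfl) u

end VectorValued

section Consequences

variable {E : Type*} [NormedAddCommGroup E] [NormedSpace ℝ E]
  {H : Type*} [TopologicalSpace H] {I : ModelWithCorners ℝ E H}
  {G : Type*} [TopologicalSpace G] [ChartedSpace H G] [Group G]
  [FiniteDimensional ℝ E] [CompleteSpace E] [LieGroup I ∞ G]

variable (I G) in
/-- The Lie bracket of the Lie algebra, as a bilinear map. -/
def lieBilin :
    GroupLieAlgebra I G →ₗ[ℝ] GroupLieAlgebra I G →ₗ[ℝ] GroupLieAlgebra I G :=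
  LinearMap.mk₂ ℝ (fun X Y ↦ ⁅X, Y⁆) add_lie smul_lie lie_add (fun c X Y ↦ lie_smul c X Y)

variable (I G) in
/-- The Lie bracket of the Lie algebra, as a continuous bilinear map on the model space. -/
def lieModel : E →L[ℝ] E →L[ℝ] E :=
  LinearMap.toContinuousLinearMap
    ((LinearMap.toContinuousLinearMap (𝕜 := ℝ) (E := E) (F' := E)).toLinearMap ∘ₗ
      (show E →ₗ[ℝ] E →ₗ[ℝ] E from lieBilin I G))

/-- A bilinear form is invariant under the adjoint representation. -/
def IsAdInvariant (b : LinearMap.BilinForm ℝ (GroupLieAlgebra I G)) : Prop :=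
  ∀ (x : G) (u v : GroupLieAlgebra I G), b (Ad I x u) (Ad I x v) = b u v

lemma IsAdInvariant.lie_add [I.Boundaryless] {b : LinearMap.BilinForm ℝ (GroupLieAlgebra I G)}
    (hb : IsAdInvariant b) (X u v : GroupLieAlgebra I G) : b ⁅X, u⁆ v + b u ⁅X, v⁆ = 0 := by
  have h := mvfderiv_bilin (bilinL b) (mdifferentiable_Ad_inv_apply (I := I) (G := G) u 1)
    (mdifferentiable_Ad_inv_apply (I := I) (G := G) v 1) X
  have hc : (fun y : G ↦ bilinL b (AdModel I y⁻¹ u) (AdModel I y⁻¹ v)) = fun _ ↦ b u v :=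
    funext fun y ↦ hb y⁻¹ u v
  rw [hc, mvfderiv_const] at h
  have h' : (0 : ℝ) = b (-⁅X, u⁆) (Ad I (1 : G)⁻¹ v) + b (Ad I (1 : G)⁻¹ u) (-⁅X, v⁆) := by
    refine h.trans ?_
    rw [mvfderiv_Ad_inv, mvfderiv_Ad_inv]
    rfl
  rw [inv_one, Ad_one, Ad_one] at h'
  simp only [map_neg, LinearMap.neg_apply] at h'
  linarith

variable {E' : Type*} [NormedAddCommGroup E'] [NormedSpace ℝ E']
  {H' : Type*} [TopologicalSpace H'] {J : ModelWithCorners ℝ E' H'}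
  {K : Type*} [TopologicalSpace K] [ChartedSpace H' K] [Group K]
  [FiniteDimensional ℝ E'] [CompleteSpace E'] [LieGroup J ∞ K]

/-- The differential of a homomorphism of Lie groups preserves brackets. -/
lemma homDeriv_lie [I.Boundaryless] [J.Boundaryless] (φ : K →* G) (hφ : MDifferentiable J I φ)
    (X Y : GroupLieAlgebra J K) :
    homDeriv I J φ ⁅X, Y⁆ = ⁅homDeriv I J φ X, homDeriv I J φ Y⁆ := by
  let L : E' →L[ℝ] E := homDeriv I J φ
  have h1 := mvfderiv_clm_comp L (mdifferentiable_Ad_inv_apply (I := J) (G := K) Y 1) X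
  have h2 := mvfderiv_comp_of_eq' (I := I) (I' := J) (f := φ)
    (g := fun x : G ↦ AdModel I x⁻¹ (L Y))
    (mdifferentiable_Ad_inv_apply (I := I) (L Y) 1) (hφ 1) (map_one φ) X
  have h3 : (fun x : K ↦ L (AdModel J x⁻¹ Y)) = (fun x : K ↦ AdModel I (φ x)⁻¹ (L Y)) :=
    funext fun x ↦ by
      rw [← map_inv]
      exact homDeriv_Ad φ hφ x⁻¹ Y
  rw [h3, h2, mvfderiv_Ad_inv] at h1
  have h4 : (-⁅homDeriv I J φ X, homDeriv I J φ Y⁆ : GroupLieAlgebra I G) =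
      homDeriv I J φ (-⁅X, Y⁆) :=
    (mvfderiv_Ad_inv (homDeriv I J φ X) (homDeriv I J φ Y)).symm.trans h1
  rw [map_neg, neg_inj] at h4
  exact h4.symm

end Consequences

section LeviCivita

variable {E : Type*} [NormedAddCommGroup E] [NormedSpace ℝ E]
  {H : Type*} [TopologicalSpace H] {I : ModelWithCorners ℝ E H}
  {G : Type*} [TopologicalSpace G] [ChartedSpace H G] [Group G]
  [FiniteDimensional ℝ E] [CompleteSpace E] [LieGroup I ∞ G]

variable (I G) in
/-- The connection with `∇_X Y = [X, Y] / 2` for left-invariant vector fields `X`, `Y`. -/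
def halfLieCov : CovariantDerivative I E (TangentSpace I : G → Type _) :=
  (leftFlatCov I G).addOneForm fun x ↦
    (leftTrivSymmModel I x).postcomp (TangentSpace I x) ∘L
      ((leftTrivModel I x).precomp E ∘L ((2⁻¹ : ℝ) • (lieModel I G).flip ∘L leftTrivModel I x))

lemma leftTrivModel_halfLieCov (Y : ∀ x : G, TangentSpace I x) (x : G) (u : TangentSpace I x) :
    leftTrivModel I x (halfLieCov I G Y x u) =
      mvfderiv I (fun y ↦ leftTrivModel I y (Y y)) x u +
        (2⁻¹ : ℝ) • lieModel I G (leftTrivModel I x u) (leftTrivModel I x (Y x)) := by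
  have : halfLieCov I G Y x u = leftTrivSymmModel I x
      (mvfderiv I (fun y ↦ leftTrivModel I y (Y y)) x u) + leftTrivSymmModel I x
        ((2⁻¹ : ℝ) • lieModel I G (leftTrivModel I x u) (leftTrivModel I x (Y x))) := rfl
  rw [this, map_add, leftTrivModel_leftTrivSymmModel, leftTrivModel_leftTrivSymmModel]

lemma halfLieCov_mulInvariantVectorField (u v : GroupLieAlgebra I G) (x : G) :
    halfLieCov I G (mulInvariantVectorField v) x (mulInvariantVectorField u x) =
      (2⁻¹ : ℝ) • mulInvariantVectorField ⁅u, v⁆ x := by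
  have h := leftFlatCov_mulInvariantVectorField v x (mulInvariantVectorField u x)
  have : halfLieCov I G (mulInvariantVectorField v) x (mulInvariantVectorField u x) =
      leftFlatCov I G (mulInvariantVectorField v) x (mulInvariantVectorField u x) +
      leftTrivSymmModel I x ((2⁻¹ : ℝ) • lieModel I G
        (leftTrivModel I x (mulInvariantVectorField u x))
        (leftTrivModel I x (mulInvariantVectorField v x))) := rfl
  rw [this, h, zero_add, map_smul]
  congr 1
  exact congrArg (leftTrivSymmModel I x) (congrArg₂ (fun a b ↦ lieModel I G a b)
    (leftTrivModel_mulInvariantVectorField (E := E) u x)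
    (leftTrivModel_mulInvariantVectorField (E := E) v x))

lemma halfLieCov_torsion : (halfLieCov I G).torsion = 0 := by
  ext x u v
  obtain ⟨u, rfl⟩ : ∃ u' : GroupLieAlgebra I G, u = mulInvariantVectorField u' x :=
    ⟨leftTriv I x u, (leftTrivSymm_leftTriv x u).symm⟩
  obtain ⟨v, rfl⟩ : ∃ v' : GroupLieAlgebra I G, v = mulInvariantVectorField v' x :=
    ⟨leftTriv I x v, (leftTrivSymm_leftTriv x v).symm⟩
  rw [CovariantDerivative.torsion_apply _ (mdifferentiableAt_mulInvariantVectorField _)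
    (mdifferentiableAt_mulInvariantVectorField _), halfLieCov_mulInvariantVectorField,
    halfLieCov_mulInvariantVectorField, ← mulInvariantVector_mlieBracket,
    ← GroupLieAlgebra.bracket_def, ← lie_skew u v, ← neg_one_smul ℝ ⁅v, u⁆,
    mulInvariantVectorField_smul]
  simp only [Pi.smul_apply, Pi.zero_apply, zero_apply]
  module

lemma isLeviCivita_halfLieCov {b : LinearMap.BilinForm ℝ (GroupLieAlgebra I G)}
    (hb : ∀ X u v : GroupLieAlgebra I G, b ⁅X, u⁆ v + b u ⁅X, v⁆ = 0) :
    IsLeviCivita (leftInvariantField b) (halfLieCov I G) := by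
  refine ⟨halfLieCov_torsion, fun x Y Z hY hZ u ↦ ?_⟩
  have h := mvfderiv_bilin (bilinL b) (mdifferentiableAt_leftTriv_apply hY)
    (mdifferentiableAt_leftTriv_apply hZ) u
  have h0 := hb (leftTriv I x u) (leftTriv I x (Y x)) (leftTriv I x (Z x))
  refine h.trans ?_
  have e1 : leftInvariantField b x (halfLieCov I G Y x u) (Z x) =
    bilinL b (leftTrivModel I x (halfLieCov I G Y x u)) (leftTrivModel I x (Z x)) := rfl
  have e2 : leftInvariantField b x (Y x) (halfLieCov I G Z x u) =
    bilinL b (leftTrivModel I x (Y x)) (leftTrivModel I x (halfLieCov I G Z x u)) := rfl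
  have e3 : bilinL b (lieModel I G (leftTrivModel I x u) (leftTrivModel I x (Y x)))
      (leftTrivModel I x (Z x)) + bilinL b (leftTrivModel I x (Y x))
        (lieModel I G (leftTrivModel I x u) (leftTrivModel I x (Z x))) = 0 := h0
  rw [e1, e2, leftTrivModel_halfLieCov, leftTrivModel_halfLieCov]
  simp only [map_add, map_smul, add_apply, smul_apply,
    smul_eq_mul]
  linarith

end LeviCivita

section Invariance

variable {E : Type*} [NormedAddCommGroup E] [NormedSpace ℝ E]
  {H : Type*} [TopologicalSpace H] {I : ModelWithCorners ℝ E H}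
  {G : Type*} [TopologicalSpace G] [ChartedSpace H G]

lemma bilinField_congr (q : BilinField I G) {x y : G} (h : x = y) (u v : E) :
    q x u v = q y u v := by
  subst h; rfl

variable [Group G]

lemma leftInvariantField_apply (b : LinearMap.BilinForm ℝ (GroupLieAlgebra I G)) (x : G)
    (u v : TangentSpace I x) :
    leftInvariantField b x u v = b (leftTriv I x u) (leftTriv I x v) := rfl

lemma IsLeftInvariant.apply_eq {q : BilinField I G} (hq : IsLeftInvariant q) (x : G)
    (u v : TangentSpace I x) : q x u v = q 1 (leftTriv I x u) (leftTriv I x v) := by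
  rw [← hq x⁻¹ x u v]
  exact bilinField_congr q (inv_mul_cancel x) _ _

variable [LieGroup I ∞ G]

lemma isLeftInvariant_leftInvariantField (b : LinearMap.BilinForm ℝ (GroupLieAlgebra I G)) :
    IsLeftInvariant (leftInvariantField b) := by
  intro a x u v
  rw [leftInvariantField_apply, leftTriv_mul_left, leftTriv_mul_left, leftInvariantField_apply]

lemma isBiInvariant_leftInvariantField {b : LinearMap.BilinForm ℝ (GroupLieAlgebra I G)}
    (hb : IsAdInvariant b) : IsBiInvariant (leftInvariantField b) := by
  refine ⟨isLeftInvariant_leftInvariantField b, fun a x u v ↦ ?_⟩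
  rw [leftInvariantField_apply, leftTriv_mul_right, leftTriv_mul_right, hb,
    leftInvariantField_apply]

lemma IsBiInvariant.isAdInvariant {q : BilinField I G} (hq : IsBiInvariant q) :
    IsAdInvariant (q 1) := by
  intro x u v
  have h1 := hq.2 x⁻¹ 1 u v
  rw [hq.1.apply_eq, leftTriv_mul_right, leftTriv_mul_right, leftTriv_one, leftTriv_one,
    inv_inv] at h1
  exact h1

lemma leftTriv_injective (x : G) : Function.Injective (leftTriv I x) :=
  Function.LeftInverse.injective (g := leftTrivSymm I x) (leftTrivSymm_leftTriv x)

lemma leftTriv_surjective (x : G) : Function.Surjective (leftTriv I x) :=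
  Function.RightInverse.surjective (g := leftTrivSymm I x) (leftTriv_leftTrivSymm x)

lemma nondegenerate_leftInvariantField {b : LinearMap.BilinForm ℝ (GroupLieAlgebra I G)}
    (hb : b.Nondegenerate) (x : G) : (leftInvariantField b x).Nondegenerate := by
  refine ⟨fun u hu ↦ ?_, fun u hu ↦ ?_⟩
  · refine leftTriv_injective x ((hb.1 _ fun v ↦ ?_).trans (map_zero _).symm)
    obtain ⟨v, rfl⟩ := leftTriv_surjective x v
    exact hu v
  · refine leftTriv_injective x ((hb.2 _ fun v ↦ ?_).trans (map_zero _).symm)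
    obtain ⟨v, rfl⟩ := leftTriv_surjective x v
    exact hu v

lemma isSemiRiemannianMetric_leftInvariantField [FiniteDimensional ℝ E]
    {b : LinearMap.BilinForm ℝ (GroupLieAlgebra I G)}
    (hs : ∀ u v, b u v = b v u) (hb : b.Nondegenerate) :
    IsSemiRiemannianMetric (leftInvariantField b) where
  symm _ _ _ := hs _ _
  nondegenerate := nondegenerate_leftInvariantField hb
  smooth := isSmoothBilinField_leftInvariantField b

variable [FiniteDimensional ℝ E] [CompleteSpace E] [I.Boundaryless]

lemma Ad_lie (x : G) (u v : GroupLieAlgebra I G) : Ad I x ⁅u, v⁆ = ⁅Ad I x u, Ad I x v⁆ :=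
  homDeriv_lie (MulAut.conj x).toMonoidHom (fun y ↦ mdifferentiableAt_conj x y) u v

/-- `Ad x` as an automorphism of the Lie algebra. -/
def AdEquiv (x : G) : GroupLieAlgebra I G ≃ₗ⁅ℝ⁆ GroupLieAlgebra I G where
  toFun := Ad I x
  invFun := Ad I x⁻¹
  left_inv := Ad_inv_Ad x
  right_inv := Ad_Ad_inv x
  map_add' := map_add _
  map_smul' := map_smul _
  map_lie' := Ad_lie x _ _

lemma isAdInvariant_negKilling : IsAdInvariant (negKilling I G) := by
  intro x u v
  have := LieAlgebra.killingForm_of_equiv_apply (R := ℝ) (AdEquiv (I := I) x) u v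
  exact congrArg Neg.neg this

end Invariance

section PosDef

variable {V : Type*} [AddCommGroup V] [Module ℝ V]

/-- Symmetric positive definite bilinear forms. -/
structure IsPosDef (B : LinearMap.BilinForm ℝ V) : Prop where
  symm : ∀ u v, B u v = B v u
  pos : ∀ v, v ≠ 0 → 0 < B v v

lemma IsPosDef.nonneg {B : LinearMap.BilinForm ℝ V} (hB : IsPosDef B) (v : V) : 0 ≤ B v v := by
  rcases eq_or_ne v 0 with rfl | hv
  · simp
  · exact (hB.pos v hv).le

lemma IsPosDef.eq_zero {B : LinearMap.BilinForm ℝ V} (hB : IsPosDef B) {v : V} (h : B v v = 0) :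
    v = 0 := by
  by_contra hv
  exact (hB.pos v hv).ne' h

lemma IsPosDef.nondegenerate {B : LinearMap.BilinForm ℝ V} (hB : IsPosDef B) : B.Nondegenerate :=
  ⟨fun _ hv ↦ hB.eq_zero (hv _), fun _ hv ↦ hB.eq_zero (hv _)⟩

lemma IsPosDef.comp {W : Type*} [AddCommGroup W] [Module ℝ W] {B : LinearMap.BilinForm ℝ V}
    (hB : IsPosDef B) (f : W →ₗ[ℝ] V) (hf : Function.Injective f) : IsPosDef (B.comp f f) where
  symm _ _ := hB.symm _ _
  pos _ hv := hB.pos _ fun h ↦ hv (hf (h.trans (map_zero f).symm))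

/-- The inner product given by a symmetric positive definite bilinear form. -/
@[reducible]
def IsPosDef.core {B : LinearMap.BilinForm ℝ V} (hB : IsPosDef B) : InnerProductSpace.Core ℝ V where
  inner u v := B u v
  conj_inner_symm u v := by simpa using hB.symm v u
  re_inner_nonneg v := by simpa using hB.nonneg v
  add_left u v w := by simp
  smul_left u v r := by simp
  definite v hv := hB.eq_zero hv

variable [FiniteDimensional ℝ V]

lemma IsPosDef.trace_comp_self_neg {B : LinearMap.BilinForm ℝ V} (hB : IsPosDef B) {T : V →ₗ[ℝ] V}
    (hT : ∀ u v, B (T u) v + B u (T v) = 0) (hne : T ≠ 0) :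
    LinearMap.trace ℝ V (T ∘ₗ T) < 0 := by
  let _ : NormedAddCommGroup V := hB.core.toNormedAddCommGroup
  let _ : InnerProductSpace ℝ V := InnerProductSpace.ofCore hB.core.toCore
  have hinner : ∀ u v : V, inner ℝ u v = B u v := fun _ _ ↦ rfl
  rw [LinearMap.trace_eq_sum_inner _ (stdOrthonormalBasis ℝ V)]
  have key : ∀ v : V, inner ℝ v ((T ∘ₗ T) v) = -B (T v) (T v) := fun v ↦ by
    have := hT v (T v)
    rw [hinner, LinearMap.comp_apply]
    linarith
  simp only [key]
  rw [Finset.sum_neg_distrib, neg_lt_zero]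
  refine Finset.sum_pos' (fun i _ ↦ hB.nonneg _) ?_
  by_contra! hcon
  refine hne ((stdOrthonormalBasis ℝ V).toBasis.ext fun i ↦ ?_)
  have := hcon i (Finset.mem_univ i)
  simpa using hB.eq_zero (le_antisymm this (hB.nonneg _))

lemma IsPosDef.exists_eigenvector [Nontrivial V] {B h : LinearMap.BilinForm ℝ V} (hB : IsPosDef B)
    (hh : ∀ u v, h u v = h v u) : ∃ (μ : ℝ) (v : V), v ≠ 0 ∧ ∀ w, h v w = μ * B v w := by
  let _ : NormedAddCommGroup V := hB.core.toNormedAddCommGroup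
  let _ : InnerProductSpace ℝ V := InnerProductSpace.ofCore hB.core.toCore
  let A : V →ₗ[ℝ] V := (B.toDual hB.nondegenerate).symm.toLinearMap ∘ₗ h
  have hA : ∀ u v, B (A u) v = h u v := fun u v ↦
    LinearMap.BilinForm.apply_toDual_symm_apply (hB := hB.nondegenerate) ..
  have hsymm : A.IsSymmetric := fun u v ↦ by
    change B (A u) v = B u (A v)
    rw [hA, hB.symm, hA, hh]
  obtain ⟨μ, hμ⟩ : ∃ μ : ℝ, Module.End.HasEigenvalue A μ :=
    ⟨_, hsymm.hasEigenvalue_iSup_of_finiteDimensional⟩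
  obtain ⟨v, hv⟩ := hμ.exists_hasEigenvector
  refine ⟨μ, v, hv.2, fun w ↦ ?_⟩
  rw [← hA, hv.apply_eq_smul, map_smul]
  rfl

end PosDef

section InvariantForms

variable {L : Type*} [LieRing L] [LieAlgebra ℝ L]

/-- Invariance of a bilinear form under the adjoint representation of a Lie algebra. -/
def IsLieInvariant (b : LinearMap.BilinForm ℝ L) : Prop :=
  ∀ X u v : L, b ⁅X, u⁆ v + b u ⁅X, v⁆ = 0

lemma IsLieInvariant.lie_left {b : LinearMap.BilinForm ℝ L} (hb : IsLieInvariant b) (X u v : L) :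
    b ⁅X, u⁆ v = -b u ⁅X, v⁆ := by
  linarith [hb X u v]

lemma killingForm_neg [FiniteDimensional ℝ L] [LieAlgebra.IsSimple ℝ L]
    {b : LinearMap.BilinForm ℝ L} (hb : IsPosDef b) (hinv : IsLieInvariant b) :
    IsPosDef (-killingForm ℝ L) where
  symm u v := by
    simp only [LinearMap.neg_apply]
    rw [LieModule.traceForm_comm]
  pos v hv := by
    have hne : LieAlgebra.ad ℝ L v ≠ 0 := by
      intro h0
      have : v ∈ LieAlgebra.center ℝ L := by
        rw [LieModule.mem_maxTrivSubmodule]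
        intro x
        rw [← lie_skew, ← LieAlgebra.ad_apply (R := ℝ), h0]
        simp
      rw [LieAlgebra.center_eq_bot] at this
      exact hv (by simpa using this)
    have := hb.trace_comp_self_neg (T := LieAlgebra.ad ℝ L v) (fun u w ↦ hinv v u w) hne
    simpa [killingForm_apply_apply] using this

/-- On a simple Lie algebra, invariant symmetric forms are proportional to an invariant inner
product. -/
lemma exists_eq_mul_of_isSimple [FiniteDimensional ℝ L] [LieAlgebra.IsSimple ℝ L]
    {b h : LinearMap.BilinForm ℝ L} (hb : IsPosDef b) (hbinv : IsLieInvariant b)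
    (hh : ∀ u v, h u v = h v u) (hhinv : IsLieInvariant h) :
    ∃ μ : ℝ, ∀ u v, h u v = μ * b u v := by
  have : Nontrivial L := by
    by_contra hn
    rw [not_nontrivial_iff_subsingleton] at hn
    exact LieAlgebra.IsSimple.non_abelian (R := ℝ) (L := L) ⟨fun x y ↦ Subsingleton.elim _ _⟩
  obtain ⟨μ, v, hv, hvw⟩ := hb.exists_eigenvector hh
  let N : LieIdeal ℝ L :=
    { carrier := {u | ∀ w, h u w = μ * b u w}
      add_mem' := fun {x y} hx hy w ↦ by simp [hx w, hy w, mul_add]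
      zero_mem' := fun w ↦ by simp
      smul_mem' := fun c x hx w ↦ by simp [hx w]; ring
      lie_mem := fun {x u} hu w ↦ by
        rw [hhinv.lie_left, hbinv.lie_left, hu]; ring }
  have hN : N = ⊤ := by
    refine (LieAlgebra.IsSimple.eq_bot_or_eq_top N).resolve_left fun h0 ↦ hv ?_
    have : v ∈ N := hvw
    rw [h0] at this
    simpa using this
  exact ⟨μ, fun u w ↦ (hN ▸ LieSubmodule.mem_top u : u ∈ N) w⟩

lemma apply_eq_zero_of_inf_eq_bot {b : LinearMap.BilinForm ℝ L} (hb : IsLieInvariant b)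
    {N N' : LieIdeal ℝ L} [LieAlgebra.IsSimple ℝ N] (hN : ∀ z ∈ N, z ∈ N' → z = 0)
    {x y : L} (hx : x ∈ N) (hy : y ∈ N') : b x y = 0 := by
  have key : ∀ z ∈ N, ∀ x, ∀ y ∈ N', b ⁅z, x⁆ y = 0 := fun z hz x y hy ↦ by
    rw [hb.lie_left, hN ⁅z, y⁆ (lie_mem_left ℝ L N z y hz) (lie_mem_right ℝ L N' z y hy)]
    simp
  let P : LieIdeal ℝ N :=
    { carrier := {u | ∀ y ∈ N', b (u : L) y = 0}
      add_mem' := fun {x y} hx hy w hw ↦ by simp [hx w hw, hy w hw]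
      zero_mem' := fun w _ ↦ by simp
      smul_mem' := fun c x hx w hw ↦ by simp [hx w hw]
      lie_mem := fun {x u} hu w hw ↦ key _ x.2 _ _ hw }
  have hP : P = ⊤ := by
    refine (LieAlgebra.IsSimple.eq_bot_or_eq_top P).resolve_left fun h0 ↦ ?_
    refine LieAlgebra.IsSimple.non_abelian (R := ℝ) (L := N) ⟨fun u w ↦ ?_⟩
    have : ⁅u, w⁆ ∈ P := fun y hy ↦ key _ u.2 _ _ hy
    rw [h0] at this
    simpa using this
  exact (hP ▸ LieSubmodule.mem_top (⟨x, hx⟩ : N) : (⟨x, hx⟩ : N) ∈ P) y hy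

end InvariantForms

section OrthSum

variable {ι V : Type*} [Fintype ι] [DecidableEq ι] [AddCommGroup V] [Module ℝ V]
  {W : ι → Submodule ℝ V} (hW : DirectSum.IsInternal W)

omit [Fintype ι] in
lemma summandProj_mem (i : ι) (v : V) : summandProj hW i v ∈ W i := Subtype.prop _

omit [Fintype ι] in
lemma summandProj_of_mem {i : ι} {v : V} (hv : v ∈ W i) : summandProj hW i v = v :=
  congrArg Subtype.val (hW.ofBijective_coeLinearMap_of_mem hv)

omit [Fintype ι] in
lemma summandProj_of_mem_ne {i j : ι} (hij : i ≠ j) {v : V} (hv : v ∈ W i) :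
    summandProj hW j v = 0 :=
  congrArg Subtype.val (hW.ofBijective_coeLinearMap_of_mem_ne hij hv)

lemma sum_summandProj (v : V) : ∑ i, summandProj hW i v = v := by
  have h : v ∈ ⨆ i, W i := by rw [hW.submodule_iSup_eq_top]; trivial
  induction h using Submodule.iSup_induction' with
  | mem i v hv =>
    rw [Finset.sum_eq_single i (fun j _ hj ↦ summandProj_of_mem_ne hW hj.symm hv) (by simp),
      summandProj_of_mem hW hv]
  | zero => simp
  | add u v _ _ hu hv => simp only [map_add, Finset.sum_add_distrib, hu, hv]

lemma summandProj_sum {f : ι → V} (hf : ∀ i, f i ∈ W i) (j : ι) :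
    summandProj hW j (∑ i, f i) = f j := by
  rw [map_sum, Finset.sum_eq_single j (fun i _ hi ↦ summandProj_of_mem_ne hW hi (hf i)) (by simp),
    summandProj_of_mem hW (hf j)]

/-- The endomorphism of an internal direct sum that is multiplication by `c i` on `W i`. -/
def scalarSum (c : ι → ℝ) : V →ₗ[ℝ] V := ∑ i, c i • summandProj hW i

lemma scalarSum_apply (c : ι → ℝ) (v : V) :
    scalarSum hW c v = ∑ i, c i • summandProj hW i v := by
  simp [scalarSum, LinearMap.sum_apply]

lemma summandProj_scalarSum (c : ι → ℝ) (j : ι) (v : V) :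
    summandProj hW j (scalarSum hW c v) = c j • summandProj hW j v := by
  rw [scalarSum_apply, summandProj_sum hW fun i ↦ (W i).smul_mem _ (summandProj_mem hW i v)]

lemma eq_of_summandProj_eq {u v : V} (h : ∀ i, summandProj hW i u = summandProj hW i v) :
    u = v := by
  rw [← sum_summandProj hW u, ← sum_summandProj hW v]
  exact Finset.sum_congr rfl fun i _ ↦ h i

lemma scalarSum_of_mem (c : ι → ℝ) {i : ι} {v : V} (hv : v ∈ W i) :
    scalarSum hW c v = c i • v :=
  eq_of_summandProj_eq hW fun j ↦ by
    rw [summandProj_scalarSum, map_smul]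
    rcases eq_or_ne i j with rfl | hij
    · rfl
    · simp [summandProj_of_mem_ne hW hij hv]

lemma scalarSum_const_add (s : ℝ) (c : ι → ℝ) (v : V) :
    scalarSum hW (fun i ↦ s + c i) v = s • v + scalarSum hW c v :=
  eq_of_summandProj_eq hW fun i ↦ by simp only [summandProj_scalarSum, map_add, map_smul, add_smul]

lemma scalarSum_const_mul (s : ℝ) (c : ι → ℝ) (v : V) :
    scalarSum hW (fun i ↦ s * c i) v = s • scalarSum hW c v :=
  eq_of_summandProj_eq hW fun i ↦ by simp only [summandProj_scalarSum, map_smul, mul_smul]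

lemma scalarSum_eq_zero {c : ι → ℝ} (hc : ∀ i, c i ≠ 0) {v : V} (hv : scalarSum hW c v = 0) :
    v = 0 := by
  refine eq_of_summandProj_eq hW fun i ↦ ?_
  have := summandProj_scalarSum hW c i v
  rw [hv, map_zero, eq_comm, smul_eq_zero] at this
  simpa using this.resolve_left (hc i)

/-- An operator commuting with `⊕ c_i` commutes with `⊕ d_i` if `d_i` is a function of `c_i`. -/
lemma scalarSum_comm_of_comm {c d : ι → ℝ} (hcd : ∀ i j, c i = c j → d i = d j) {T : V →ₗ[ℝ] V}
    (hT : ∀ v, T (scalarSum hW c v) = scalarSum hW c (T v)) (v : V) :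
    T (scalarSum hW d v) = scalarSum hW d (T v) := by
  have key : ∀ i, ∀ v ∈ W i, T (scalarSum hW d v) = scalarSum hW d (T v) := fun i v hv ↦ by
    refine eq_of_summandProj_eq hW fun j ↦ ?_
    have h := congrArg (summandProj hW j) (hT v)
    rw [scalarSum_of_mem hW _ hv, map_smul, map_smul, summandProj_scalarSum] at h
    rw [scalarSum_of_mem hW _ hv, map_smul, map_smul, summandProj_scalarSum]
    rcases eq_or_ne (summandProj hW j (T v)) 0 with h0 | h0
    · simp [h0]
    · rw [hcd i j (smul_left_injective ℝ h0 h)]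
  rw [← sum_summandProj hW v]
  simp only [map_sum]
  exact Finset.sum_congr rfl fun i _ ↦ key i _ (summandProj_mem hW i v)

variable {B : LinearMap.BilinForm ℝ V}

lemma orthSum_apply (c : ι → ℝ) (B : LinearMap.BilinForm ℝ V) (u v : V) :
    orthSum hW c B u v = ∑ i, c i * B (summandProj hW i u) (summandProj hW i v) := by
  simp [orthSum, LinearMap.sum_apply]

variable (hB : ∀ i j, i ≠ j → ∀ u ∈ W i, ∀ v ∈ W j, B u v = 0)
include hB

lemma apply_eq_sum_summandProj (u v : V) :
    B u v = ∑ i, B (summandProj hW i u) (summandProj hW i v) := by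
  conv_lhs => rw [← sum_summandProj hW u, ← sum_summandProj hW v]
  simp only [map_sum, LinearMap.sum_apply]
  refine Finset.sum_congr rfl fun i _ ↦ ?_
  rw [Finset.sum_eq_single i _ (by simp)]
  exact fun j _ hj ↦ hB j i hj _ (summandProj_mem hW j u) _ (summandProj_mem hW i v)

lemma orthSum_eq_apply_scalarSum (c : ι → ℝ) (u v : V) :
    orthSum hW c B u v = B (scalarSum hW c u) v := by
  rw [orthSum_apply, apply_eq_sum_summandProj hW hB]
  simp [summandProj_scalarSum]

omit hB in
lemma orthSum_symm (hs : ∀ u v, B u v = B v u) (c : ι → ℝ) (u v : V) :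
    orthSum hW c B u v = orthSum hW c B v u := by
  simp only [orthSum_apply]
  exact Finset.sum_congr rfl fun i _ ↦ by rw [hs]

lemma orthSum_nondegenerate (hp : IsPosDef B) {c : ι → ℝ} (hc : ∀ i, c i ≠ 0) :
    (orthSum hW c B).Nondegenerate := by
  have key : ∀ u, (∀ v, orthSum hW c B u v = 0) → u = 0 := fun u hu ↦ by
    refine scalarSum_eq_zero hW hc (hp.eq_zero ?_)
    rw [← orthSum_eq_apply_scalarSum hW hB]
    exact hu _
  exact ⟨key, fun u hu ↦ key u fun v ↦ (orthSum_symm hW hp.symm c u v).trans (hu v)⟩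

lemma orthSum_isometry (hp : IsPosDef B) {c d : ι → ℝ} (hcd : ∀ i j, c i = c j → d i = d j)
    {T : V →ₗ[ℝ] V} (hsurj : Function.Surjective T) (hT : ∀ u v, B (T u) (T v) = B u v)
    (hc : ∀ u v, orthSum hW c B (T u) (T v) = orthSum hW c B u v) (u v : V) :
    orthSum hW d B (T u) (T v) = orthSum hW d B u v := by
  have hcomm : ∀ v, T (scalarSum hW c v) = scalarSum hW c (T v) := fun v ↦ by
    refine sub_eq_zero.1 (hp.eq_zero ?_)
    obtain ⟨w, hw⟩ := hsurj (T (scalarSum hW c v) - scalarSum hW c (T v))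
    nth_rw 2 [← hw]
    rw [map_sub, LinearMap.sub_apply, hT, ← orthSum_eq_apply_scalarSum hW hB,
      ← orthSum_eq_apply_scalarSum hW hB, hc, sub_self]
  rw [orthSum_eq_apply_scalarSum hW hB, orthSum_eq_apply_scalarSum hW hB,
    ← scalarSum_comm_of_comm hW hcd hcomm, hT]

end OrthSum

section SimpleIdeals

variable {ι L : Type*} [Fintype ι] [DecidableEq ι] [LieRing L] [LieAlgebra ℝ L]
  [FiniteDimensional ℝ L] {N : ι → LieIdeal ℝ L}
  (hN : DirectSum.IsInternal (fun i ↦ (N i).toSubmodule))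
  (hsimple : ∀ i, LieAlgebra.IsSimple ℝ (N i))
  {B h : LinearMap.BilinForm ℝ L}

include hN hsimple

omit [Fintype ι] [FiniteDimensional ℝ L] in
lemma apply_eq_zero_of_ne (hB : IsLieInvariant B) (i j : ι) (hij : i ≠ j) (u : L)
    (hu : u ∈ (N i).toSubmodule) (v : L) (hv : v ∈ (N j).toSubmodule) : B u v = 0 := by
  have := hsimple i
  refine apply_eq_zero_of_inf_eq_bot hB (N := N i) (N' := N j) (fun z hz hzj ↦ ?_) hu hv
  exact Submodule.disjoint_def.1 (hN.submodule_iSupIndep.pairwiseDisjoint hij) z hz hzj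

/-- Two invariant inner products on a direct sum of simple Lie algebras differ by positive factors
on the summands, which are unique. -/
theorem existsUnique_eq_orthSum_exp (hBp : IsPosDef B) (hB : IsLieInvariant B) (hhp : IsPosDef h)
    (hh : IsLieInvariant h) :
    ∃! a : ι → ℝ, h = orthSum hN (fun i ↦ Real.exp (a i)) B := by
  have hne : ∀ i, ∃ v ∈ (N i).toSubmodule, v ≠ 0 := fun i ↦ by
    by_contra! hcon
    have := hsimple i
    refine LieAlgebra.IsSimple.non_abelian (R := ℝ) (L := N i) ⟨fun u w ↦ ?_⟩
    exact Subtype.ext (hcon _ (⁅u, w⁆ : N i).2)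
  have hprop : ∀ i, ∃ a : ℝ, ∀ u ∈ (N i).toSubmodule, ∀ v ∈ (N i).toSubmodule,
      h u v = Real.exp a * B u v := fun i ↦ by
    have := hsimple i
    obtain ⟨μ, hμ⟩ := exists_eq_mul_of_isSimple (L := N i)
      (b := B.comp (N i).toSubmodule.subtype (N i).toSubmodule.subtype)
      (h := h.comp (N i).toSubmodule.subtype (N i).toSubmodule.subtype)
      (hBp.comp _ (Submodule.subtype_injective _)) (fun X u v ↦ hB X u v)
      (fun u v ↦ hhp.symm _ _) (fun X u v ↦ hh X u v)
    obtain ⟨v, hv, hv0⟩ := hne i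
    have hpos : 0 < μ := by
      have h1 : h v v = μ * B v v := hμ ⟨v, hv⟩ ⟨v, hv⟩
      have := hhp.pos v hv0
      rw [h1] at this
      exact pos_of_mul_pos_left this (hBp.nonneg v)
    refine ⟨Real.log μ, fun u hu v hv ↦ ?_⟩
    rw [Real.exp_log hpos]
    exact hμ ⟨u, hu⟩ ⟨v, hv⟩
  choose a ha using hprop
  refine ⟨a, ?_, fun a' ha' ↦ funext fun i ↦ ?_⟩
  · ext u v
    rw [orthSum_apply, apply_eq_sum_summandProj hN (apply_eq_zero_of_ne hN hsimple hh)]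
    exact Finset.sum_congr rfl fun i _ ↦
      ha i _ (summandProj_mem hN i u) _ (summandProj_mem hN i v)
  · obtain ⟨v, hv, hv0⟩ := hne i
    have h1 := ha i v hv v hv
    rw [ha', orthSum_eq_apply_scalarSum hN (apply_eq_zero_of_ne hN hsimple hB),
      scalarSum_of_mem hN _ hv, map_smul] at h1
    exact Real.exp_injective (mul_right_cancel₀ (hBp.pos v hv0).ne' h1)

end SimpleIdeals

section Compact

variable {E : Type*} [NormedAddCommGroup E] [NormedSpace ℝ E] [FiniteDimensional ℝ E]
  {H : Type*} [TopologicalSpace H] {I : ModelWithCorners ℝ E H}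
  {G : Type*} [TopologicalSpace G] [ChartedSpace H G] [Group G] [LieGroup I ∞ G]

lemma continuous_apply_Ad_inv (S : LinearMap.BilinForm ℝ (GroupLieAlgebra I G))
    (u v : GroupLieAlgebra I G) : Continuous fun x : G ↦ S (Ad I x⁻¹ u) (Ad I x⁻¹ v) := by
  have := topologicalGroup_of_lieGroup I ∞ (G := G)
  have hu : Continuous fun x : G ↦ AdModel I x⁻¹ u :=
    (continuous_Ad_apply (I := I) u).comp continuous_inv
  have hv : Continuous fun x : G ↦ AdModel I x⁻¹ v :=
    (continuous_Ad_apply (I := I) v).comp continuous_inv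
  exact ((bilinL S).continuous.comp hu).clm_apply hv

/-- The Lie algebra of a compact Lie group has an invariant inner product, obtained by averaging. -/
theorem exists_isAdInvariant_isPosDef [CompactSpace G] [T2Space G]
    {S : LinearMap.BilinForm ℝ (GroupLieAlgebra I G)} (hS : IsPosDef S) :
    ∃ b : LinearMap.BilinForm ℝ (GroupLieAlgebra I G), IsPosDef b ∧ IsAdInvariant b := by
  have := topologicalGroup_of_lieGroup I ∞ (G := G)
  let _ : MeasurableSpace G := borel G
  have : BorelSpace G := ⟨rfl⟩
  let μ : MeasureTheory.Measure G := MeasureTheory.Measure.haar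
  have hint : ∀ u v : GroupLieAlgebra I G,
      MeasureTheory.Integrable (fun x : G ↦ S (Ad I x⁻¹ u) (Ad I x⁻¹ v)) μ := fun u v ↦
    (continuous_apply_Ad_inv S u v).integrable_of_hasCompactSupport
      (HasCompactSupport.of_compactSpace _)
  let b : LinearMap.BilinForm ℝ (GroupLieAlgebra I G) :=
    LinearMap.mk₂ ℝ (fun u v ↦ ∫ x, S (Ad I x⁻¹ u) (Ad I x⁻¹ v) ∂μ)
      (fun u u' v ↦ by
        simp only [map_add, LinearMap.add_apply]
        exact MeasureTheory.integral_add (hint u v) (hint u' v))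
      (fun c u v ↦ by
        simp only [map_smul, LinearMap.smul_apply]
        exact MeasureTheory.integral_smul c _)
      (fun u v v' ↦ by
        simp only [map_add]
        exact MeasureTheory.integral_add (hint u v) (hint u v'))
      (fun c u v ↦ by
        simp only [map_smul]
        exact MeasureTheory.integral_smul c _)
  have hb : ∀ u v, b u v = ∫ x, S (Ad I x⁻¹ u) (Ad I x⁻¹ v) ∂μ := fun u v ↦ rfl
  refine ⟨b, ⟨fun u v ↦ ?_, fun v hv ↦ ?_⟩, fun a u v ↦ ?_⟩
  · rw [hb, hb]
    simp only [hS.symm]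
  · refine (continuous_apply_Ad_inv S v v).integral_pos_of_hasCompactSupport_nonneg_nonzero
      (HasCompactSupport.of_compactSpace _) (fun x ↦ hS.nonneg _) (x := 1) ?_
    rw [inv_one, Ad_one]
    exact (hS.pos v hv).ne'
  · rw [hb, hb, ← MeasureTheory.integral_mul_left_eq_self _ a]
    simp only [mul_inv_rev, Ad_mul, Ad_inv_Ad]

variable [CompleteSpace E] [I.Boundaryless]

lemma IsAdInvariant.isLieInvariant {b : LinearMap.BilinForm ℝ (GroupLieAlgebra I G)}
    (hb : IsAdInvariant b) : IsLieInvariant b := hb.lie_add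

theorem isPosDef_negKilling [CompactSpace G] [T2Space G]
    [LieAlgebra.IsSimple ℝ (GroupLieAlgebra I G)]
    {S : LinearMap.BilinForm ℝ (GroupLieAlgebra I G)} (hS : IsPosDef S) :
    IsPosDef (negKilling I G) := by
  obtain ⟨b, hb, hinv⟩ := exists_isAdInvariant_isPosDef hS
  have : FiniteDimensional ℝ (GroupLieAlgebra I G) := inferInstanceAs (FiniteDimensional ℝ E)
  exact killingForm_neg hb hinv.isLieInvariant

end Compact

section Subgroup

variable {E : Type*} [NormedAddCommGroup E] [NormedSpace ℝ E] [FiniteDimensional ℝ E]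
  [CompleteSpace E] {H : Type*} [TopologicalSpace H] {I : ModelWithCorners ℝ E H} [I.Boundaryless]
  {G : Type*} [TopologicalSpace G] [ChartedSpace H G] [Group G] [LieGroup I ∞ G]
  {F : Type*} [NormedAddCommGroup F] [NormedSpace ℝ F]
  {H' : Type*} [TopologicalSpace H'] {J : ModelWithCorners ℝ F H'}
  {K : Subgroup G} [ChartedSpace H' K] [LieGroup J ∞ K]

omit [FiniteDimensional ℝ E] [CompleteSpace E] [I.Boundaryless] [LieGroup I ∞ G]
  [LieGroup J ∞ K] in
lemma IsLieSubgroup.mdifferentiable (hK : IsLieSubgroup I J K) : MDifferentiable J I K.subtype :=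
  hK.smooth.mdifferentiable (by simp)

omit [FiniteDimensional ℝ E] [CompleteSpace E] [I.Boundaryless] in
lemma lieIncl_Ad (hK : IsLieSubgroup I J K) (k : K) (X : GroupLieAlgebra J K) :
    lieIncl I J K (Ad J k X) = Ad I (k : G) (lieIncl I J K X) :=
  homDeriv_Ad K.subtype hK.mdifferentiable k X

lemma isAdInvariant_negKillingRestrict (hK : IsLieSubgroup I J K) :
    IsAdInvariant (negKillingRestrict I J K) := by
  intro k X Y
  change negKilling I G (lieIncl I J K (Ad J k X)) (lieIncl I J K (Ad J k Y)) = _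
  rw [lieIncl_Ad hK, lieIncl_Ad hK, isAdInvariant_negKilling]
  rfl

omit [FiniteDimensional ℝ E] [I.Boundaryless] [LieGroup J ∞ K] in
lemma isPosDef_negKillingRestrict (hK : IsLieSubgroup I J K) (h : IsPosDef (negKilling I G)) :
    IsPosDef (negKillingRestrict I J K) :=
  h.comp _ (hK.immersion 1)

end Subgroup

section Product

variable {E : Type*} [NormedAddCommGroup E] [NormedSpace ℝ E]
  {H : Type*} [TopologicalSpace H] {I : ModelWithCorners ℝ E H}
  {G : Type*} [TopologicalSpace G] [ChartedSpace H G] [Group G]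
  {F : Type*} [NormedAddCommGroup F] [NormedSpace ℝ F]
  {H' : Type*} [TopologicalSpace H'] {J : ModelWithCorners ℝ F H'}
  {K : Type*} [TopologicalSpace K] [ChartedSpace H' K] [Group K]

variable (I G J K) in
/-- The first projection of the Lie algebra of `G × K`. -/
def lieFst : GroupLieAlgebra (I.prod J) (G × K) →ₗ[ℝ] GroupLieAlgebra I G :=
  (homDeriv I (I.prod J) (MonoidHom.fst G K)).toLinearMap

variable (I G J K) in
/-- The second projection of the Lie algebra of `G × K`. -/
def lieSnd : GroupLieAlgebra (I.prod J) (G × K) →ₗ[ℝ] GroupLieAlgebra J K :=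
  (homDeriv J (I.prod J) (MonoidHom.snd G K)).toLinearMap

/-- The element of the Lie algebra of `G × K` with given components. -/
def lieProdMk (U : GroupLieAlgebra I G) (X : GroupLieAlgebra J K) :
    GroupLieAlgebra (I.prod J) (G × K) :=
  ((U, X) : E × F)

lemma lieFst_apply (U : GroupLieAlgebra (I.prod J) (G × K)) :
    lieFst I G J K U = (show E × F from U).1 :=
  congr($(mfderiv_fst (I := I) (I' := J) (x := (1 : G × K))) U)

lemma lieSnd_apply (U : GroupLieAlgebra (I.prod J) (G × K)) :
    lieSnd I G J K U = (show E × F from U).2 :=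
  congr($(mfderiv_snd (I := I) (I' := J) (x := (1 : G × K))) U)

@[simp]
lemma lieFst_lieProdMk (U : GroupLieAlgebra I G) (X : GroupLieAlgebra J K) :
    lieFst I G J K (lieProdMk U X) = U := lieFst_apply _

@[simp]
lemma lieSnd_lieProdMk (U : GroupLieAlgebra I G) (X : GroupLieAlgebra J K) :
    lieSnd I G J K (lieProdMk U X) = X := lieSnd_apply _

lemma lieProd_ext {U V : GroupLieAlgebra (I.prod J) (G × K)}
    (h₁ : lieFst I G J K U = lieFst I G J K V) (h₂ : lieSnd I G J K U = lieSnd I G J K V) :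
    U = V := by
  rw [lieFst_apply, lieFst_apply] at h₁
  rw [lieSnd_apply, lieSnd_apply] at h₂
  exact Prod.ext h₁ h₂

/-- The orthogonal sum of bilinear forms on the Lie algebras of `G` and `K`. -/
def prodForm (b : LinearMap.BilinForm ℝ (GroupLieAlgebra I G))
    (b' : LinearMap.BilinForm ℝ (GroupLieAlgebra J K)) :
    LinearMap.BilinForm ℝ (GroupLieAlgebra (I.prod J) (G × K)) :=
  b.comp (lieFst I G J K) (lieFst I G J K) + b'.comp (lieSnd I G J K) (lieSnd I G J K)

variable (b : LinearMap.BilinForm ℝ (GroupLieAlgebra I G))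
  (b' : LinearMap.BilinForm ℝ (GroupLieAlgebra J K))

lemma prodForm_apply (U V : GroupLieAlgebra (I.prod J) (G × K)) :
    prodForm b b' U V = b (lieFst I G J K U) (lieFst I G J K V) +
      b' (lieSnd I G J K U) (lieSnd I G J K V) := rfl

variable {b b'}

lemma nondegenerate_prodForm (hb : b.Nondegenerate) (hb' : b'.Nondegenerate) :
    (prodForm b b').Nondegenerate := by
  refine ⟨fun U hU ↦ lieProd_ext ?_ ?_, fun U hU ↦ lieProd_ext ?_ ?_⟩ <;> rw [map_zero]
  · exact hb.1 _ fun V ↦ by simpa [prodForm_apply] using hU (lieProdMk V 0)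
  · exact hb'.1 _ fun V ↦ by simpa [prodForm_apply] using hU (lieProdMk 0 V)
  · exact hb.2 _ fun V ↦ by simpa [prodForm_apply] using hU (lieProdMk V 0)
  · exact hb'.2 _ fun V ↦ by simpa [prodForm_apply] using hU (lieProdMk 0 V)

variable [LieGroup I ∞ G] [LieGroup J ∞ K]

lemma lieFst_leftTriv (p : G × K) (u : TangentSpace (I.prod J) p) :
    lieFst I G J K (leftTriv (I.prod J) p u) =
      leftTriv I p.1 (mfderiv (I.prod J) I Prod.fst p u) :=
  (leftTriv_hom (MonoidHom.fst G K) mdifferentiable_fst p u).symm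

lemma lieSnd_leftTriv (p : G × K) (u : TangentSpace (I.prod J) p) :
    lieSnd I G J K (leftTriv (I.prod J) p u) =
      leftTriv J p.2 (mfderiv (I.prod J) J Prod.snd p u) :=
  (leftTriv_hom (MonoidHom.snd G K) mdifferentiable_snd p u).symm

lemma lieFst_Ad (p : G × K) (U : GroupLieAlgebra (I.prod J) (G × K)) :
    lieFst I G J K (Ad (I.prod J) p U) = Ad I p.1 (lieFst I G J K U) :=
  homDeriv_Ad (MonoidHom.fst G K) mdifferentiable_fst p U

lemma lieSnd_Ad (p : G × K) (U : GroupLieAlgebra (I.prod J) (G × K)) :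
    lieSnd I G J K (Ad (I.prod J) p U) = Ad J p.2 (lieSnd I G J K U) :=
  homDeriv_Ad (MonoidHom.snd G K) mdifferentiable_snd p U

variable (b b') in
lemma prodField_leftInvariantField :
    prodField (leftInvariantField b) (leftInvariantField b') =
      leftInvariantField (prodForm b b') := by
  funext p
  ext u v
  rw [leftInvariantField_apply, prodForm_apply, lieFst_leftTriv, lieFst_leftTriv,
    lieSnd_leftTriv, lieSnd_leftTriv]
  rfl

lemma isAdInvariant_prodForm (hb : IsAdInvariant b) (hb' : IsAdInvariant b') :
    IsAdInvariant (prodForm b b') := by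
  intro p U V
  simp only [prodForm_apply, lieFst_Ad, lieSnd_Ad, hb p.1, hb' p.2]

end Product

section ProductRule

variable {E : Type*} [NormedAddCommGroup E] [NormedSpace ℝ E]
  {H : Type*} [TopologicalSpace H] {I : ModelWithCorners ℝ E H}
  {G : Type*} [TopologicalSpace G] [ChartedSpace H G] [Group G] [LieGroup I ∞ G]
  {F : Type*} [NormedAddCommGroup F] [NormedSpace ℝ F]
  {H' : Type*} [TopologicalSpace H'] {J : ModelWithCorners ℝ F H'}
  {M : Type*} [TopologicalSpace M] [ChartedSpace H' M]

/-- The product rule for maps to a Lie group, in the left trivialization. -/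
lemma leftTriv_mfderiv_mul {f h k : M → G} {x : M} (hf : MDifferentiableAt J I f x)
    (hh : MDifferentiableAt J I h x) (hk : ∀ y, k y = f y * h y) (u : TangentSpace J x) :
    leftTriv I (k x) (mfderiv J I k x u) =
      Ad I (h x)⁻¹ (leftTriv I (f x) (mfderiv J I f x u)) +
        leftTriv I (h x) (mfderiv J I h x u) := by
  obtain rfl : k = fun y ↦ f y * h y := funext hk
  have hm : MDifferentiableAt (I.prod I) I (fun p : G × G ↦ p.1 * p.2) (f x, h x) :=
    (contMDiff_mul I ∞).mdifferentiable (by simp) _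
  have h1 := mfderiv_apply_of_factor (k := fun y ↦ f y * h y) hm (hf.prodMk hh) rfl
    (fun _ ↦ rfl) u
  rw [mfderiv_prodMk hf hh] at h1
  have h2 := h1.trans (mfderiv_prod_eq_add_apply hm)
  have h3 := congrArg (leftTriv I (f x * h x)) h2
  rw [← leftTriv_mul_right, ← leftTriv_mul_left (f x) (h x)]
  exact h3.trans (map_add _ _ _)

end ProductRule

section Quotient

variable {E : Type*} [NormedAddCommGroup E] [NormedSpace ℝ E]
  {H : Type*} [TopologicalSpace H] {I : ModelWithCorners ℝ E H}
  {G : Type*} [TopologicalSpace G] [ChartedSpace H G] [Group G]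
  {F : Type*} [NormedAddCommGroup F] [NormedSpace ℝ F]
  {H' : Type*} [TopologicalSpace H'] {J : ModelWithCorners ℝ F H'}
  {K : Subgroup G} [ChartedSpace H' K]

variable (K) in
/-- The map `(g, k) ↦ g k⁻¹`. -/
def divMap (p : G × K) : G := p.1 * (p.2 : G)⁻¹

variable (K) in
/-- The diagonal embedding of `K` in `G × K`. -/
def diagHom : K →* G × K := K.subtype.prod (MonoidHom.id K)

omit [TopologicalSpace G] in
lemma divMap_mul_diagHom (p : G × K) (m : K) : divMap K (p * diagHom K m) = divMap K p := by
  simp [divMap, diagHom, mul_assoc]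

variable (I J K) in
/-- The differential of `divMap` at the identity. -/
def lieDiff : GroupLieAlgebra (I.prod J) (G × K) →ₗ[ℝ] GroupLieAlgebra I G :=
  lieFst I G J K - lieIncl I J K ∘ₗ lieSnd I G J K

lemma lieDiff_apply (U : GroupLieAlgebra (I.prod J) (G × K)) :
    lieDiff I J K U = lieFst I G J K U - lieIncl I J K (lieSnd I G J K U) := rfl

variable (I J K) in
/-- The differential of `diagHom` at the identity. -/
def lieDiag (X : GroupLieAlgebra J K) : GroupLieAlgebra (I.prod J) (G × K) :=
  lieProdMk (lieIncl I J K X) X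

@[simp]
lemma lieFst_lieDiag (X : GroupLieAlgebra J K) :
    lieFst I G J K (lieDiag I J K X) = lieIncl I J K X := lieFst_lieProdMk _ _

@[simp]
lemma lieSnd_lieDiag (X : GroupLieAlgebra J K) : lieSnd I G J K (lieDiag I J K X) = X :=
  lieSnd_lieProdMk _ _

lemma lieDiff_eq_zero_iff {U : GroupLieAlgebra (I.prod J) (G × K)} :
    lieDiff I J K U = 0 ↔ ∃ X, U = lieDiag I J K X := by
  constructor
  · intro h
    rw [lieDiff_apply, sub_eq_zero] at h
    exact ⟨_, lieProd_ext (by rw [lieFst_lieDiag, h]) (by rw [lieSnd_lieDiag])⟩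
  · rintro ⟨X, rfl⟩
    rw [lieDiff_apply, lieFst_lieDiag, lieSnd_lieDiag, sub_self]

lemma mdifferentiable_diagHom (hK : IsLieSubgroup I J K) :
    MDifferentiable J (I.prod J) (diagHom K) :=
  fun m ↦ (hK.mdifferentiable m).prodMk mdifferentiableAt_id

lemma homDeriv_diagHom (hK : IsLieSubgroup I J K) (X : GroupLieAlgebra J K) :
    homDeriv (I.prod J) J (diagHom K) X = lieDiag I J K X := by
  have h := mfderiv_prodMk (hK.mdifferentiable 1) (mdifferentiableAt_id (I := J) (x := (1 : K)))
  rw [mfderiv_id] at h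
  exact congr($h X)

variable [LieGroup I ∞ G] [LieGroup J ∞ K]

omit [LieGroup J ∞ K] in
lemma contMDiff_divMap (hK : IsLieSubgroup I J K) : ContMDiff (I.prod J) I ∞ (divMap K) :=
  contMDiff_fst.mul (hK.smooth.comp contMDiff_snd).inv

omit [TopologicalSpace G] in
lemma surjective_divMap : Function.Surjective (divMap K) := fun x ↦ ⟨(x, 1), by simp [divMap]⟩

lemma leftTriv_mfderiv_divMap (hK : IsLieSubgroup I J K) (p : G × K)
    (u : TangentSpace (I.prod J) p) :
    leftTriv I (divMap K p) (mfderiv (I.prod J) I (divMap K) p u) =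
      Ad I (p.2 : G) (lieDiff I J K (leftTriv (I.prod J) p u)) := by
  have h1 := leftTriv_mfderiv_mul (f := divMap K) (h := fun p : G × K ↦ (p.2 : G))
    (k := Prod.fst) (x := p) ((contMDiff_divMap hK).mdifferentiable (by simp) p)
    ((hK.smooth.comp contMDiff_snd).mdifferentiable (by simp) p) (fun y ↦ by simp [divMap]) u
  rw [← lieFst_leftTriv] at h1
  have h2 : leftTriv I (p.2 : G)
      (mfderiv (I.prod J) I (fun p : G × K ↦ (p.2 : G)) p u) =
        lieIncl I J K (lieSnd I G J K (leftTriv (I.prod J) p u)) := by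
    rw [lieSnd_leftTriv]
    refine Eq.trans ?_ (leftTriv_hom K.subtype hK.mdifferentiable p.2 _)
    exact congrArg (leftTriv I (p.2 : G)) (mfderiv_apply_of_factor (hK.mdifferentiable p.2)
      mdifferentiableAt_snd rfl (fun _ ↦ rfl) u)
  rw [h2] at h1
  rw [lieDiff_apply, h1, add_sub_cancel_right, Ad_Ad_inv]

lemma Ad_injective (x : G) : Function.Injective (Ad I x) :=
  Function.LeftInverse.injective (g := Ad I x⁻¹) (Ad_inv_Ad x)

lemma mem_vertical_divMap_iff (hK : IsLieSubgroup I J K) (p : G × K)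
    (u : TangentSpace (I.prod J) p) :
    u ∈ vertical (I.prod J) I (divMap K) p ↔ lieDiff I J K (leftTriv (I.prod J) p u) = 0 := by
  have h := leftTriv_mfderiv_divMap hK p u
  constructor
  · intro hu
    have hu' : mfderiv (I.prod J) I (divMap K) p u = 0 := hu
    rw [hu', map_zero] at h
    exact Ad_injective _ (h.symm.trans (map_zero _).symm)
  · intro hu
    rw [hu, map_zero] at h
    exact leftTriv_injective (divMap K p) (h.trans (map_zero _).symm)

lemma surjective_mfderiv_divMap (hK : IsLieSubgroup I J K) (p : G × K) :
    Function.Surjective (mfderiv (I.prod J) I (divMap K) p) := by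
  intro v
  let W : GroupLieAlgebra I G := Ad I (p.2 : G)⁻¹ (leftTriv I (divMap K p) v)
  obtain ⟨u, hu⟩ := leftTriv_surjective (I := I.prod J) p (lieProdMk W (0 : GroupLieAlgebra J K))
  refine ⟨u, leftTriv_injective (divMap K p) ?_⟩
  rw [leftTriv_mfderiv_divMap hK, hu, lieDiff_apply, lieFst_lieProdMk, lieSnd_lieProdMk, map_zero,
    sub_zero, Ad_Ad_inv]

/-- The fibers of `divMap` are nondegenerate if `b ⊕ b'` is nondegenerate on the diagonal. -/
lemma nondegenerate_restrict_vertical (hK : IsLieSubgroup I J K)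
    {b : LinearMap.BilinForm ℝ (GroupLieAlgebra I G)}
    {b' : LinearMap.BilinForm ℝ (GroupLieAlgebra J K)} (hb : ∀ U V, b U V = b V U)
    (hb' : ∀ X Y, b' X Y = b' Y X)
    (hnd : ∀ X, (∀ Y, b (lieIncl I J K X) (lieIncl I J K Y) + b' X Y = 0) → X = 0) (p : G × K) :
    ((leftInvariantField (prodForm b b') p).restrict
      (vertical (I.prod J) I (divMap K) p)).Nondegenerate := by
  have key : ∀ u ∈ vertical (I.prod J) I (divMap K) p,
      (∀ v ∈ vertical (I.prod J) I (divMap K) p,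
        leftInvariantField (prodForm b b') p u v = 0) → u = 0 := by
    intro u hu h
    obtain ⟨X, hX⟩ := lieDiff_eq_zero_iff.1 ((mem_vertical_divMap_iff hK p u).1 hu)
    suffices X = 0 by
      refine leftTriv_injective p (hX.trans ?_)
      rw [this, map_zero]
      exact lieProd_ext (by rw [lieFst_lieDiag, map_zero, map_zero])
        (by rw [lieSnd_lieDiag, map_zero])
    refine hnd X fun Y ↦ ?_
    obtain ⟨v, hv⟩ := leftTriv_surjective (I := I.prod J) p (lieDiag I J K Y)
    have := h v ((mem_vertical_divMap_iff hK p v).2 (lieDiff_eq_zero_iff.2 ⟨Y, hv⟩))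
    rw [leftInvariantField_apply, hX, hv, prodForm_apply, lieFst_lieDiag, lieFst_lieDiag,
      lieSnd_lieDiag, lieSnd_lieDiag] at this
    exact this
  refine ⟨fun u hu ↦ Subtype.ext (key u u.2 fun v hv ↦ hu ⟨v, hv⟩),
    fun u hu ↦ Subtype.ext (key u u.2 fun v hv ↦ ?_)⟩
  refine Eq.trans ?_ (hu ⟨v, hv⟩)
  change prodForm b b' _ _ = prodForm b b' _ _
  rw [prodForm_apply, prodForm_apply, hb, hb']
  rfl

variable [FiniteDimensional ℝ E] [CompleteSpace E] [I.Boundaryless]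
  [FiniteDimensional ℝ F] [CompleteSpace F] [J.Boundaryless]

/-- The fibers of `divMap` are left translates of a subgroup, hence totally geodesic. -/
lemma fibersTotallyGeodesicFor_divMap (hK : IsLieSubgroup I J K) :
    FibersTotallyGeodesicFor (I.prod J) I (halfLieCov (I.prod J) (G × K)) (divMap K) := by
  intro p u hu Y hY hYv
  obtain ⟨X, hX⟩ := lieDiff_eq_zero_iff.1 ((mem_vertical_divMap_iff hK p u).1 hu)
  obtain ⟨X', hX'⟩ := lieDiff_eq_zero_iff.1
    ((mem_vertical_divMap_iff hK p (Y p)).1 (hYv.self_of_nhds rfl))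
  rw [mem_vertical_divMap_iff hK]
  let f : G × K → E × F := fun y ↦ leftTrivModel (I.prod J) y (Y y)
  have hf : MDifferentiableAt (I.prod J) 𝓘(ℝ, E × F) f p :=
    mdifferentiableAt_leftTriv_apply (hY.mdifferentiableAt (by simp))
  let D : E × F →L[ℝ] E := LinearMap.toContinuousLinearMap (show E × F →ₗ[ℝ] E from lieDiff I J K)
  let γ : K → G × K := fun m ↦ p * diagHom K m
  have hγ : MDifferentiableAt J (I.prod J) γ 1 :=
    (mdifferentiableAt_mul_left' p (diagHom K 1)).comp 1 (mdifferentiable_diagHom hK 1)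
  have hγ1 : γ 1 = p := by simp [γ]
  have hdγ : (mfderiv J (I.prod J) γ 1 X : E × F) = u := by
    have h1 := mfderiv_apply_of_factor (k := γ) (mdifferentiableAt_mul_left' (I := I.prod J) p 1)
      (mdifferentiable_diagHom hK 1) (map_one _) (fun _ ↦ rfl) X
    have h2 : (mfderiv J (I.prod J) (diagHom K) 1 X : E × F) = leftTriv (I.prod J) p u :=
      (homDeriv_diagHom hK X).trans hX.symm
    rw [h2] at h1
    exact h1.trans (leftTrivSymm_leftTriv p u)
  have hzero : ∀ᶠ m in 𝓝 (1 : K), D (f (γ m)) = 0 := by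
    have hc : Filter.Tendsto γ (𝓝 1) (𝓝 p) := by
      have := hγ.continuousAt
      rwa [ContinuousAt, hγ1] at this
    filter_upwards [hc.eventually hYv] with m hm
    exact (mem_vertical_divMap_iff hK _ _).1 (hm (divMap_mul_diagHom p m))
  have hD : D (mvfderiv (I.prod J) f p u) = 0 := by
    have h1 := mvfderiv_clm_comp D hf u
    have hDf : MDifferentiableAt (I.prod J) 𝓘(ℝ, E) (fun y ↦ D (f y)) p :=
      D.differentiableAt.mdifferentiableAt.comp p hf
    have h2 := mvfderiv_comp_of_eq' hDf hγ hγ1 X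
    rw [hdγ] at h2
    rw [← h1, ← h2]
    have h3 : mfderiv J 𝓘(ℝ, E) (fun m ↦ D (f (γ m))) 1 =
        mfderiv J 𝓘(ℝ, E) (fun _ : K ↦ (0 : E)) 1 :=
      Filter.EventuallyEq.mfderiv_eq hzero
    rw [mfderiv_const] at h3
    exact congr($h3 X)
  have hbr : D (lieModel (I.prod J) (G × K) (leftTrivModel (I.prod J) p u)
      (leftTrivModel (I.prod J) p (Y p))) = 0 := by
    refine lieDiff_eq_zero_iff.2 ⟨⁅X, X'⁆, ?_⟩
    rw [← homDeriv_diagHom hK, homDeriv_lie _ (mdifferentiable_diagHom hK), homDeriv_diagHom hK,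
      homDeriv_diagHom hK, ← hX, ← hX']
    rfl
  have h := congrArg D (leftTrivModel_halfLieCov Y p u)
  rw [map_add, map_smul, hbr, hD, smul_zero, add_zero] at h
  exact h

end Quotient

section Decomposition

variable {E : Type*} [NormedAddCommGroup E] [NormedSpace ℝ E] [CompleteSpace E]
  {H : Type*} [TopologicalSpace H] {I : ModelWithCorners ℝ E H}
  {G : Type*} [TopologicalSpace G] [ChartedSpace H G] [Group G] [LieGroup I ∞ G]
  {F : Type*} [NormedAddCommGroup F] [NormedSpace ℝ F]
  {H' : Type*} [TopologicalSpace H'] {J : ModelWithCorners ℝ F H'}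
  {K : Subgroup G} [ChartedSpace H' K]

lemma exists_orthComplement_add [FiniteDimensional ℝ F] (hK : IsLieSubgroup I J K)
    (hκ : IsPosDef (negKilling I G)) (U : GroupLieAlgebra I G) :
    ∃ Z ∈ orthComplement I J K, ∃ X, U = Z + lieIncl I J K X := by
  have : FiniteDimensional ℝ (GroupLieAlgebra J K) := inferInstanceAs (FiniteDimensional ℝ F)
  have hB := isPosDef_negKillingRestrict hK hκ
  let X : GroupLieAlgebra J K := ((negKillingRestrict I J K).toDual hB.nondegenerate).symm
    (negKilling I G U ∘ₗ lieIncl I J K)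
  have hX : ∀ Y, negKilling I G (lieIncl I J K X) (lieIncl I J K Y) =
      negKilling I G U (lieIncl I J K Y) := fun Y ↦
    LinearMap.BilinForm.apply_toDual_symm_apply (hB := hB.nondegenerate)
      (negKilling I G U ∘ₗ lieIncl I J K) Y
  refine ⟨U - lieIncl I J K X, fun Y ↦ ?_, X, (sub_add_cancel _ _).symm⟩
  rw [hκ.symm, map_sub, LinearMap.sub_apply, hX, sub_self]

lemma negKilling_add_lieIncl (hκ : IsPosDef (negKilling I G)) {Z Z' : GroupLieAlgebra I G}
    (hZ : Z ∈ orthComplement I J K) (hZ' : Z' ∈ orthComplement I J K)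
    (X X' : GroupLieAlgebra J K) :
    negKilling I G (Z + lieIncl I J K X) (Z' + lieIncl I J K X') =
      negKilling I G Z Z' + negKillingRestrict I J K X X' := by
  simp only [map_add, LinearMap.add_apply, hZ' X, hκ.symm Z, hZ X']
  simp [negKillingRestrict]

variable {α : ℝ} {h : BilinField J K} {g : BilinField I G}

lemma IsMetricOfType.apply_add_lieIncl (hg : IsMetricOfType α h g)
    (hs : ∀ U V : GroupLieAlgebra I G, g 1 U V = g 1 V U) {Z Z' : GroupLieAlgebra I G}
    (hZ : Z ∈ orthComplement I J K) (hZ' : Z' ∈ orthComplement I J K)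
    (X X' : GroupLieAlgebra J K) :
    g 1 (Z + lieIncl I J K X) (Z' + lieIncl I J K X') =
      Real.exp α * negKilling I G Z Z' + h 1 X X' := by
  have h1 : g 1 (Z + lieIncl I J K X) (Z' + lieIncl I J K X') =
      g 1 Z Z' + g 1 (lieIncl I J K X) Z' + (g 1 Z (lieIncl I J K X') +
        g 1 (lieIncl I J K X) (lieIncl I J K X')) := by
    rw [LinearMap.map_add₂, map_add, map_add]
    ring
  rw [h1, hs Z (lieIncl I J K X'), hg.orthogonal X Z' hZ', hg.orthogonal X' Z hZ,
    hg.on_complement Z hZ Z' hZ', hg.on_subalgebra]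
  ring

/-- The metric on horizontal vectors: `(Z + X₁, X₂) ∈ (𝔭 ⊕ 𝔨) ⊕ 𝔨` is horizontal iff
`X₁ = ⊕ d_i X₂` with `d_i = -e^{-α} β_i`, and its image is `Z + X₁ - X₂`. -/
lemma IsMetricOfType.apply_lieDiff [FiniteDimensional ℝ F] {ι : Type*} [Fintype ι] [DecidableEq ι]
    {W : ι → Submodule ℝ (GroupLieAlgebra J K)} (hW : DirectSum.IsInternal W)
    (hg : IsMetricOfType α h g)
    (hs : ∀ U V : GroupLieAlgebra I G, g 1 U V = g 1 V U) (hK : IsLieSubgroup I J K)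
    (hκ : IsPosDef (negKilling I G))
    (horth : ∀ i j, i ≠ j → ∀ u ∈ W i, ∀ v ∈ W j, negKillingRestrict I J K u v = 0)
    {c β : ι → ℝ} (hh : h 1 = orthSum hW c (negKillingRestrict I J K))
    (hc : ∀ i, c i * (Real.exp (-α) * β i + 1) = β i)
    {U V : GroupLieAlgebra (I.prod J) (G × K)}
    (hU : ∀ X, prodForm (Real.exp α • negKilling I G) (orthSum hW β (negKillingRestrict I J K)) U
      (lieDiag I J K X) = 0)
    (hV : ∀ X, prodForm (Real.exp α • negKilling I G) (orthSum hW β (negKillingRestrict I J K)) V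
      (lieDiag I J K X) = 0) :
    g 1 (lieDiff I J K U) (lieDiff I J K V) =
      prodForm (Real.exp α • negKilling I G) (orthSum hW β (negKillingRestrict I J K)) U V := by
  have hB := isPosDef_negKillingRestrict hK hκ
  have key : ∀ U : GroupLieAlgebra (I.prod J) (G × K),
      (∀ X, prodForm (Real.exp α • negKilling I G) (orthSum hW β (negKillingRestrict I J K)) U
        (lieDiag I J K X) = 0) → ∃ Z ∈ orthComplement I J K, lieFst I G J K U =
          Z + lieIncl I J K (scalarSum hW (fun i ↦ -Real.exp (-α) * β i) (lieSnd I G J K U)) := by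
    intro U hU
    obtain ⟨Z, hZ, X, hX⟩ := exists_orthComplement_add hK hκ (lieFst I G J K U)
    refine ⟨Z, hZ, hX.trans ?_⟩
    congr 2
    rw [scalarSum_const_mul]
    have h0 : ∀ Y, negKillingRestrict I J K
        (Real.exp α • X + scalarSum hW β (lieSnd I G J K U)) Y = 0 := fun Y ↦ by
      have h1 := hU Y
      rw [prodForm_apply, lieFst_lieDiag, lieSnd_lieDiag, hX,
        orthSum_eq_apply_scalarSum hW horth] at h1
      have h2 : negKilling I G Z (lieIncl I J K Y) = 0 := (hκ.symm _ _).trans (hZ Y)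
      rw [map_add, map_smul, LinearMap.add_apply, LinearMap.smul_apply]
      rw [LinearMap.smul_apply, LinearMap.smul_apply, map_add, LinearMap.add_apply, h2,
        zero_add] at h1
      exact h1
    have h3 := hB.eq_zero (h0 _)
    rw [neg_smul, ← smul_neg, ← eq_neg_of_add_eq_zero_left h3, smul_smul, ← Real.exp_add]
    simp
  obtain ⟨Z, hZ, hUZ⟩ := key U hU
  obtain ⟨Z', hZ', hVZ⟩ := key V hV
  rw [prodForm_apply, lieDiff_apply, lieDiff_apply, hUZ, hVZ, add_sub_assoc, add_sub_assoc,
    ← map_sub, ← map_sub, hg.apply_add_lieIncl hs hZ hZ', LinearMap.smul_apply,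
    LinearMap.smul_apply, negKilling_add_lieIncl hκ hZ hZ', hh,
    apply_eq_sum_summandProj hW horth, orthSum_apply, orthSum_apply, smul_eq_mul, mul_add,
    add_assoc, Finset.mul_sum, ← Finset.sum_add_distrib]
  congr 1
  refine Finset.sum_congr rfl fun i _ ↦ ?_
  simp only [map_sub, summandProj_scalarSum, LinearMap.sub_apply, map_smul, LinearMap.smul_apply,
    smul_eq_mul]
  have he : Real.exp α * Real.exp (-α) = 1 := by rw [← Real.exp_add]; simp
  generalize negKillingRestrict I J K _ _ = s
  linear_combination (s * (Real.exp (-α) * β i + 1)) * hc i - s * β i ^ 2 * Real.exp (-α) * he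

variable [LieGroup J ∞ K] [FiniteDimensional ℝ E] [I.Boundaryless]

lemma Ad_mem_orthComplement (hK : IsLieSubgroup I J K) (k : K) {Z : GroupLieAlgebra I G}
    (hZ : Z ∈ orthComplement I J K) : Ad I (k : G) Z ∈ orthComplement I J K := fun X ↦ by
  rw [← Ad_Ad_inv k X, lieIncl_Ad hK, isAdInvariant_negKilling]
  exact hZ _

lemma IsMetricOfType.apply_Ad [FiniteDimensional ℝ F] (hg : IsMetricOfType α h g)
    (hs : ∀ U V : GroupLieAlgebra I G, g 1 U V = g 1 V U) (hK : IsLieSubgroup I J K)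
    (hκ : IsPosDef (negKilling I G)) (hh : IsAdInvariant (h 1)) (k : K)
    (U V : GroupLieAlgebra I G) : g 1 (Ad I (k : G) U) (Ad I (k : G) V) = g 1 U V := by
  obtain ⟨Z, hZ, X, rfl⟩ := exists_orthComplement_add hK hκ U
  obtain ⟨W, hW, Y, rfl⟩ := exists_orthComplement_add hK hκ V
  rw [map_add (Ad I (k : G)), map_add (Ad I (k : G)), ← lieIncl_Ad hK, ← lieIncl_Ad hK,
    hg.apply_add_lieIncl hs (Ad_mem_orthComplement hK k hZ) (Ad_mem_orthComplement hK k hW),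
    hg.apply_add_lieIncl hs hZ hW, isAdInvariant_negKilling, hh]

end Decomposition

end SemiRiem

end

theorem proposition5p3
    {E : Type*} [NormedAddCommGroup E] [NormedSpace ℝ E] [FiniteDimensional ℝ E] [CompleteSpace E]
    {H : Type*} [TopologicalSpace H] (I : ModelWithCorners ℝ E H) [I.Boundaryless]
    {F : Type*} [NormedAddCommGroup F] [NormedSpace ℝ F] [FiniteDimensional ℝ F] [CompleteSpace F]
    {H' : Type*} [TopologicalSpace H'] (J : ModelWithCorners ℝ F H') [J.Boundaryless]
    -- a compact Lie group `G` with simple Lie algebra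
    {G : Type*} [TopologicalSpace G] [T2Space G] [CompactSpace G] [ChartedSpace H G] [Group G]
    [LieGroup I ∞ G] [LieAlgebra.IsSimple ℝ (GroupLieAlgebra I G)]
    -- a closed (embedded Lie) subgroup `K` with semisimple Lie algebra
    (K : Subgroup G) (hKclosed : IsClosed (K : Set G)) [ChartedSpace H' K] [LieGroup J ∞ K]
    (hK : IsLieSubgroup I J K) [LieAlgebra.IsSemisimple ℝ (GroupLieAlgebra J K)]
    -- the decomposition of the Lie algebra of `K` in simple ideals
    (r : ℕ) (𝔨 : Fin r → LieIdeal ℝ (GroupLieAlgebra J K))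
    (hsimple : ∀ i, LieAlgebra.IsSimple ℝ (𝔨 i))
    (hsum : DirectSum.IsInternal (fun i ↦ (𝔨 i).toSubmodule))
    -- the metric `g = g_{α,h}`, where `h` is a bi-invariant Riemannian metric on `K`
    (α : ℝ) (h : BilinField J K) (hh : IsRiemannianMetric h) (hbi : IsBiInvariant h)
    (g : BilinField I G) (hg : IsRiemannianMetric g) (hgαh : IsMetricOfType α h g) :
    -- there are unique `α_i` such that `h = ⊕ e^{α_i} g₀|𝔨_i`
    (∃! a : Fin r → ℝ,
      h 1 = orthSum hsum (fun i ↦ Real.exp (a i)) (negKillingRestrict I J K)) ∧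
    ∀ a : Fin r → ℝ,
      h 1 = orthSum hsum (fun i ↦ Real.exp (a i)) (negKillingRestrict I J K) →
      (∀ i, a i ≠ α) →
      ∀ β : Fin r → ℝ, (∀ i, β i = Real.exp α / (Real.exp (α - a i) - 1)) →
      ∀ htilde : BilinField J K,
        htilde = leftInvariantField (orthSum hsum β (negKillingRestrict I J K)) →
        IsSemiRiemannianMetric htilde ∧ IsBiInvariant htilde ∧
        IsSemiRiemannianSubmersion
          (prodField (leftInvariantField (Real.exp α • negKilling I G)) htilde) g
          (fun p : G × K ↦ p.1 * (p.2 : G)⁻¹) ∧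
        HasTotallyGeodesicFibers I
          (prodField (leftInvariantField (Real.exp α • negKilling I G)) htilde)
          (fun p : G × K ↦ p.1 * (p.2 : G)⁻¹) := by
  have : FiniteDimensional ℝ (GroupLieAlgebra J K) := inferInstanceAs (FiniteDimensional ℝ F)
  have hκ : IsPosDef (negKilling I G) :=
    isPosDef_negKilling (S := g 1) ⟨hg.symm 1, hg.pos 1⟩
  have hκinv := isAdInvariant_negKilling (I := I) (G := G)
  have hB : IsPosDef (negKillingRestrict I J K) := isPosDef_negKillingRestrict hK hκ
  have hBinv := isAdInvariant_negKillingRestrict hK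
  have hhp : IsPosDef (h 1) := ⟨hh.symm 1, hh.pos 1⟩
  have hhinv : IsAdInvariant (h 1) := hbi.isAdInvariant
  refine ⟨existsUnique_eq_orthSum_exp hsum hsimple hB hBinv.isLieInvariant hhp
    hhinv.isLieInvariant, ?_⟩
  rintro a ha hne β hβ _ rfl
  have horth := apply_eq_zero_of_ne hsum hsimple hBinv.isLieInvariant
  have hden : ∀ i, Real.exp (α - a i) - 1 ≠ 0 := fun i h0 ↦ hne i <| by
    rw [sub_eq_zero, Real.exp_eq_one_iff] at h0
    linarith
  have hβ0 : ∀ i, β i ≠ 0 := fun i ↦ by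
    rw [hβ]
    exact div_ne_zero (Real.exp_ne_zero _) (hden i)
  have hαβ : ∀ i, Real.exp α + β i ≠ 0 := fun i ↦ by
    have : Real.exp α + β i = Real.exp α * Real.exp (α - a i) / (Real.exp (α - a i) - 1) := by
      rw [hβ]
      field_simp [hden i]
      ring
    rw [this]
    exact div_ne_zero (mul_ne_zero (Real.exp_ne_zero _) (Real.exp_ne_zero _)) (hden i)
  have hc : ∀ i, Real.exp (a i) * (Real.exp (-α) * β i + 1) = β i := fun i ↦ by
    have h1 : Real.exp (-α) * Real.exp α = 1 := by rw [← Real.exp_add]; simp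
    have h2 : Real.exp (a i) * Real.exp (α - a i) = Real.exp α := by rw [← Real.exp_add]; simp
    rw [hβ]
    field_simp [hden i]
    linear_combination Real.exp (a i) * h1 + h2
  have hβs : ∀ X Y, orthSum hsum β (negKillingRestrict I J K) X Y =
      orthSum hsum β (negKillingRestrict I J K) Y X := orthSum_symm hsum hB.symm β
  have hβnd := orthSum_nondegenerate hsum horth hB hβ0
  have hβinv : IsAdInvariant (orthSum hsum β (negKillingRestrict I J K)) := fun k X Y ↦
    orthSum_isometry hsum horth hB (c := fun i ↦ Real.exp (a i))
      (fun i j hij ↦ by rw [hβ, hβ, Real.exp_injective hij]) (T := (Ad J k).toLinearMap)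
      (fun X ↦ ⟨Ad J k⁻¹ X, Ad_Ad_inv k X⟩) (hBinv k) (by rw [← ha]; exact hhinv k) X Y
  have hκs : ∀ U V, (Real.exp α • negKilling I G) U V = (Real.exp α • negKilling I G) V U :=
    fun U V ↦ congrArg (Real.exp α * ·) (hκ.symm U V)
  have hκα : IsPosDef (Real.exp α • negKilling I G) :=
    ⟨hκs, fun v hv ↦ mul_pos (Real.exp_pos α) (hκ.pos v hv)⟩
  have hκαinv : IsAdInvariant (Real.exp α • negKilling I G) :=
    fun x U V ↦ congrArg (Real.exp α * ·) (hκinv x U V)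
  rw [prodField_leftInvariantField]
  refine ⟨isSemiRiemannianMetric_leftInvariantField hβs hβnd,
    isBiInvariant_leftInvariantField hβinv, ?_, halfLieCov (I.prod J) (G × K),
    isLeviCivita_halfLieCov (isAdInvariant_prodForm hκαinv hβinv).lie_add,
    fibersTotallyGeodesicFor_divMap hK⟩
  refine
    { source_metric := isSemiRiemannianMetric_leftInvariantField
        (fun U V ↦ by rw [prodForm_apply, prodForm_apply, hκs, hβs])
        (nondegenerate_prodForm hκα.nondegenerate hβnd)
      target_metric := ⟨hg.symm, fun x ↦ IsPosDef.nondegenerate ⟨hg.symm x, hg.pos x⟩, hg.smooth⟩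
      smooth := contMDiff_divMap hK
      surjective := surjective_divMap
      submersion := surjective_mfderiv_divMap hK
      nondegenerate_fibers := nondegenerate_restrict_vertical hK hκs hβs fun X hX ↦ ?_
      isometry_horizontal := fun p u v hu hv ↦ ?_ }
  · have hX' : ∀ Y, negKillingRestrict I J K (scalarSum hsum (fun i ↦ Real.exp α + β i) X) Y = 0 :=
      fun Y ↦ by
        rw [scalarSum_const_add, map_add, map_smul, LinearMap.add_apply,
          ← orthSum_eq_apply_scalarSum hsum horth]
        exact hX Y
    exact scalarSum_eq_zero hsum hαβ (hB.eq_zero (hX' _))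
  · change g (divMap K p) (mfderiv (I.prod J) I (divMap K) p u)
      (mfderiv (I.prod J) I (divMap K) p v) = _
    have hhor : ∀ w : TangentSpace (I.prod J) p,
        (∀ z ∈ vertical (I.prod J) I (divMap K) p, leftInvariantField (prodForm
          (Real.exp α • negKilling I G) (orthSum hsum β (negKillingRestrict I J K))) p w z = 0) →
        ∀ X, prodForm (Real.exp α • negKilling I G) (orthSum hsum β (negKillingRestrict I J K))
          (leftTriv (I.prod J) p w) (lieDiag I J K X) = 0 := fun w hw X ↦ by
      obtain ⟨z, hz⟩ := leftTriv_surjective (I := I.prod J) p (lieDiag I J K X)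
      rw [← hz]
      exact hw z ((mem_vertical_divMap_iff hK p z).2 (lieDiff_eq_zero_iff.2 ⟨X, hz⟩))
    rw [hgαh.leftInvariant.apply_eq, leftTriv_mfderiv_divMap hK, leftTriv_mfderiv_divMap hK,
      hgαh.apply_Ad (hg.symm 1) hK hκ hhinv,
      hgαh.apply_lieDiff hsum (hg.symm 1) hK hκ horth ha hc (hhor u hu) (hhor v hv)]
    rfl
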